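/- All graphs are simple, undirected and unweighted; $d_G$ is the shortest-path metric of $G$. **Layerings.** Let $G$ be a planar graph, $v\in V(G)$, and $\Delta\ge 1$. Let $L_1,\dots,L_\Delta$ be pairwise disjoint sets (the *layers*) with union $V(G)$ and $L_1=\{v\}$. Call $(L_i)$ a *layering* of $G$ with basepoint $v$ if 1. for $2\le i\le \Delta-1$ the graph $G\setminus L_i$ has exactly two connected components, with vertex sets $\bigcup_{j<i}L_j$ and $\bigcup_{j>i}L_j$; 2. for $2\le i\le\Delta$ every $u\in L_i$ has exactly one neighbour in $L_{i-1}$, its *parent*; 3. for $1\le i\le\Delta-1$ every $w\in L_i$ has at least one neighbour in $L_{i+1}$. **Funnels.** $G$ is a *funnel* if it has a layering such that each induced subgraph $G[L_i]$ is a cycle (with at least three vertices) or a single vertex. **Pyramids.** $G$ is a *pyramid* if it has a layering such that each $G[L_i]$ is a path $u_{i,1}u_{i,2}\dots u_{i,n_i}$ with $n_i\ge 1$ (a single vertex is allowed), and the order of each layer agrees with the order of the parents: if $u_{i,j}$ is the parent of $u_{i+1,j'}$, $u_{i,t}$ is the parent of $u_{i+1,t'}$, and $j'\le t'$, then $j\le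 t$. **1-sums.** A *1-sum* of two graphs is obtained from disjoint copies of them by identifying one vertex of the first with one vertex of the second. $\oplus_1\mathsf{Pyramids}$ is the closure of the family of pyramids under 1-sums. **Stochastic embeddings.** A graph $G$ admits a *stochastic $D$-embedding* into a family $\mathcal F$ of graphs if there are a random graph $H\in\mathcal F$ and a random map $f:V(G)\to V(H)$ such that always $d_H(f(x),f(y))\ge d_G(x,y)$ for all $x,y\in V(G)$, and $\mathbb E[d_H(f(x),f(y))]\le D\, d_G(x,y)$ for all $x,y\in V(G)$. **Lemma (Pyramid representation).** There is a universal constant $D\ge 1$ such that every funnel admits a stochastic $D$-embedding into $\oplus_1\mathsf{Pyramids}$. -/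

import Mathlib

open scoped ENNReal NNReal

/-- A (finite) graph is planar if it can be drawn in the plane: vertices are distinct points
`pt x`, every edge `e` is a simple arc `arc e` joining its two endpoints, an arc contains no vertex
other than its endpoints, and two distinct arcs meet at most in a common endpoint. -/
def IsPlanar {V : Type*} (G : SimpleGraph V) : Prop :=
  ∃ (pt : V → ℝ × ℝ) (arc : Sym2 V → Set (ℝ × ℝ)),
    Function.Injective pt ∧
    (∀ x y, G.Adj x y →
      ∃ γ : Path (pt x) (pt y), Function.Injective γ ∧ Set.range γ = arc s(x, y)) ∧
    (∀ e ∈ G.edgeSet, ∀ w, pt w ∈ arc e → w ∈ e) ∧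
    (∀ e ∈ G.edgeSet, ∀ e' ∈ G.edgeSet, e ≠ e' →
      ∀ q ∈ arc e ∩ arc e', ∃ w, w ∈ e ∧ w ∈ e' ∧ q = pt w)

/-- The conditions on a family `L 0, …, L (Δ - 1)` of vertex sets (the layers, from the basepoint
outwards) that funnels and pyramids have in common. -/
structure IsLayering {V : Type*} (G : SimpleGraph V) (v : V) (Δ : ℕ) (L : Fin Δ → Set V) :
    Prop where
  /-- The layers are pairwise disjoint. -/
  disjoint : ∀ i j, i ≠ j → Disjoint (L i) (L j)
  /-- The layers cover the vertex set. -/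
  cover : ⋃ i, L i = Set.univ
  /-- The first layer consists of the basepoint. -/
  base : ∀ i, i.val = 0 → L i = {v}
  /-- Deleting a layer that is neither the first nor the last leaves exactly two connected
  components, namely the union of the earlier layers and the union of the later layers: both are
  connected, and no edge joins them. -/
  separates : ∀ i : Fin Δ, 0 < i.val → i.val + 1 < Δ →
    (G.induce (⋃ j, ⋃ _ : j < i, L j)).Connected ∧
    (G.induce (⋃ j, ⋃ _ : i < j, L j)).Connected ∧
    ∀ j k, j < i → i < k → ∀ x ∈ L j, ∀ y ∈ L k, ¬ G.Adj x y
  /-- Every vertex outside the first layer has exactly one neighbour (its parent) in the previous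
  layer. -/
  parent : ∀ i j : Fin Δ, j.val = i.val + 1 → ∀ x ∈ L j, ∃! y, y ∈ L i ∧ G.Adj x y
  /-- Every vertex outside the last layer has at least one neighbour (a child) in the next layer. -/
  child : ∀ i j : Fin Δ, j.val = i.val + 1 → ∀ y ∈ L i, ∃ x ∈ L j, G.Adj y x

/-- Funnels. The layers are cycles: `C i` lists the `i`-th layer in cyclic order, and, `C i` being
an embedding (adjacency is preserved and reflected), the edges of `G` inside a layer are precisely
the edges of the cycle. A single vertex counts as a cycle without edges. A funnel is finite since
its layers cover it. -/
def IsFunnel {V : Type*} (G : SimpleGraph V) : Prop :=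
  IsPlanar G ∧
  ∃ (v : V) (Δ : ℕ) (n : Fin Δ → ℕ) (C : ∀ i, SimpleGraph.cycleGraph (n i) ↪g G),
    (∀ i, n i = 1 ∨ 3 ≤ n i) ∧
    IsLayering G v Δ (fun i => Set.range (C i))

/-- Pyramids. The layers are (nonempty) paths: `P i` lists the `i`-th layer along the path, and the
edges of `G` inside a layer are precisely the edges of the path. The last condition says that the
order of the vertices of a layer agrees with the order of their parents in the previous layer. A
pyramid is finite since its layers cover it. -/
def IsPyramid {V : Type*} (G : SimpleGraph V) : Prop :=
  IsPlanar G ∧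
  ∃ (v : V) (Δ : ℕ) (n : Fin Δ → ℕ) (P : ∀ i, SimpleGraph.pathGraph (n i) ↪g G),
    1 ≤ Δ ∧
    (∀ i, 1 ≤ n i) ∧
    IsLayering G v Δ (fun i => Set.range (P i)) ∧
    ∀ i i' : Fin Δ, i'.val = i.val + 1 →
      ∀ (j t : Fin (n i)) (j' t' : Fin (n i')),
        G.Adj (P i j) (P i' j') → G.Adj (P i t) (P i' t') → j' ≤ t' → j ≤ t

/-- A family of graphs. -/
abbrev GraphFamily : Type 1 := (V : Type) → SimpleGraph V → Prop

/-- `K` is a 1-sum of `G` and `H`: it is the union of a copy of `G` and a copy of `H` that have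
exactly one vertex in common. -/
def IsOneSum {V W U : Type*} (G : SimpleGraph V) (H : SimpleGraph W) (K : SimpleGraph U) : Prop :=
  ∃ (f : V ↪ U) (g : W ↪ U) (z : U),
    Set.range f ∩ Set.range g = {z} ∧
    Set.range f ∪ Set.range g = Set.univ ∧
    K = G.map f ⊔ H.map g

/-- The closure of a family of graphs under 1-sums. -/
inductive OneSumClosure (F : GraphFamily) : GraphFamily
  | base {V : Type} {G : SimpleGraph V} (h : F V G) : OneSumClosure F V G
  | sum {V W U : Type} {G : SimpleGraph V} {H : SimpleGraph W} {K : SimpleGraph U}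
      (hG : OneSumClosure F V G) (hH : OneSumClosure F W H) (h : IsOneSum G H K) :
      OneSumClosure F U K

/-- The graph `G` admits a stochastic `D`-embedding into the family `F`: there are a random graph
`H` in `F` and a random map `f` from the vertices of `G` to those of `H` that is always
non-contracting for the shortest-path metrics and satisfies `𝔼 d_H(f x, f y) ≤ D * d_G(x, y)`. -/
def StochasticallyEmbeds {V : Type*} (G : SimpleGraph V) (D : ℝ≥0) (F : GraphFamily) : Prop :=
  ∃ (ι : Type) (p : PMF ι) (W : ι → Type) (H : ∀ i, SimpleGraph (W i)) (f : ∀ i, V → W i),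
    (∀ i, F (W i) (H i)) ∧
    (∀ i x y, G.edist x y ≤ (H i).edist (f i x) (f i y)) ∧
    ∀ x y, ∑' i, p i * ((H i).edist (f i x) (f i y) : ℝ≥0∞) ≤ (D : ℝ≥0∞) * (G.edist x y : ℝ≥0∞)

/-!
The argument has a topological half, which turns planarity into combinatorics, and a random half,
which cuts the funnel along random lines.

*Planarity.* For a drawing of `K₃,₃` in the plane, the changes of a logarithm of `z - w` along the
edges, as seen from the vertices, would violate a parity identity (`parity_obstruction`), so a
planar graph contains no subdivided `K₃,₃` (`IsPlanar.no_K33`). If the children of two adjacent arcs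
of a layer alternated around the next layer, then four of these children and the neighbouring ends
of the two arcs would span a `K₃,₃`; hence the parent map between two cycles is noncrossing
(`IsPlanar.noncrossing`). A noncrossing map of cycles lifts, up to reversing one of them, to a
monotone surjection `P : ℤ → ℤ` of degree one (`Noncrossing.exists_lift`). So a funnel has cyclic
coordinates: `vtx i x`, `x : ℤ`, runs periodically around layer `i`, and the parent of
`vtx (i + 1) x` is `vtx i (P i x)` with `P i` monotone of degree one
(`IsFunnel.exists_isCyclicChart`).

*Cutting.* A cut starts at a position of some layer and moves from each position to the first of its
children. It turns every layer that it meets into a path, and the parents respect the order of these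
paths, so a stretch of layers that follow the same cut is part of a pyramid. To change the cut, an
apex is inserted: a single new vertex above the next layer, with a stack of copies of that layer
between the apex and the layer itself. As the stack is at least as high as the diameter of the
layer, no distance is contracted (`IsCyclicChart.exists_lipschitz`). The graphs above and below the
apices are joined by 1-sums (`layeredGraph_mem_oneSumClosure`,
`IsCyclicChart.exists_strip_embedding`).

*Randomness.* The diameter of layer `i` is at most `layerBound n i`, a number that grows by at most
two from one layer to the next and is at most the length of the layer. Layer `i` has scale `r` if
`4 ^ r ≤ layerBound n i < 4 ^ (r + 1)`. One apex is inserted above a uniformly random one of the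
first `4 ^ r` layers of scale `r`, and the cut used below it starts at a uniformly random position
of the first layer of this scale. The independence of these choices plays no role, so they are all
residues of a single random number `U`. Hence an edge inside a layer of scale `r` is cut with
probability `O(4 ^ (-r))`, and an edge to a parent in the previous layer is interrupted by an apex
with probability `O(4 ^ (-r))`. The images of such edges have length `O(4 ^ r)`, all other edges
keep their length, and so the expected stretch is bounded (`IsCyclicChart.stochasticallyEmbeds`).
-/

/-! ### Logarithmic change of a nonvanishing curve -/

theorem exists_continuous_log {X : Type*} [TopologicalSpace X] [SimplyConnectedSpace X]
    [LocallyPathConnectedSpace X] {f : X → ℂ} (hf : Continuous f) (h0 : ∀ x, f x ≠ 0) :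
    ∃ L : X → ℂ, Continuous L ∧ ∀ x, Complex.exp (L x) = f x := by
  obtain ⟨x₀⟩ : Nonempty X := inferInstance
  obtain ⟨F, ⟨-, hF⟩, -⟩ := Complex.isCoveringMapOn_exp.existsUnique_continuousMap_lifts
    ⟨f, hf⟩ (Complex.exp_log (h0 x₀)) h0
  exact ⟨F, F.continuous, fun x => congrFun hF x⟩

/-- The total change of a continuous logarithm of `f` along `[0, 1]` (junk value `0` if `f` has no
continuous logarithm). -/
noncomputable def logChange (f : ℝ → ℂ) : ℂ :=
  open Classical in
  if h : ∃ L : ℝ → ℂ, Continuous L ∧ ∀ x, Complex.exp (L x) = f x then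
    h.choose 1 - h.choose 0 else 0

theorem logChange_eq {f L : ℝ → ℂ} (hL : Continuous L) (h : ∀ x, Complex.exp (L x) = f x) :
    logChange f = L 1 - L 0 := by
  have hex : ∃ L : ℝ → ℂ, Continuous L ∧ ∀ x, Complex.exp (L x) = f x := ⟨L, hL, h⟩
  rw [logChange, dif_pos hex]
  set L' := hex.choose
  have hL' : Continuous L' := hex.choose_spec.1
  have h' : ∀ x, Complex.exp (L' x) = f x := hex.choose_spec.2
  have key : (fun x => L' x + (L 0 - L' 0)) = L := by
    refine Complex.isCoveringMap_exp.eq_of_comp_eq (by fun_prop) hL ?_ 0 (by simp)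
    funext x
    refine Subtype.ext ?_
    simp [Complex.exp_add, Complex.exp_sub, h, h']
    have : f 0 ≠ 0 := by rw [← h]; exact Complex.exp_ne_zero _
    field_simp
  have := congrFun key 1
  linear_combination this

theorem logChange_neg {f : ℝ → ℂ} (hf : Continuous f) (h0 : ∀ x, f x ≠ 0) :
    logChange (fun x => -f x) = logChange f := by
  obtain ⟨L, hL, h⟩ := exists_continuous_log hf h0
  rw [logChange_eq hL h, logChange_eq (L := fun x => L x + Real.pi * Complex.I) (by fun_prop)]
  · ring
  · intro x
    simp [Complex.exp_add, h]

/-- The logarithmic change is determined by the endpoints up to a multiple of `2πi`. -/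
theorem exists_logChange_eq {f : ℝ → ℂ} (hf : Continuous f) (h0 : ∀ x, f x ≠ 0) {a b : ℂ}
    (ha : Complex.exp a = f 0) (hb : Complex.exp b = f 1) :
    ∃ k : ℤ, logChange f = b - a + k * (2 * Real.pi * Complex.I) := by
  obtain ⟨L, hL, h⟩ := exists_continuous_log hf h0
  rw [logChange_eq hL h]
  obtain ⟨k, hk⟩ := Complex.exp_eq_exp_iff_exists_int.1 ((h 0).trans ha.symm)
  obtain ⟨l, hl⟩ := Complex.exp_eq_exp_iff_exists_int.1 ((h 1).trans hb.symm)
  refine ⟨l - k, ?_⟩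
  rw [hk, hl]; push_cast; ring

/-- A nonvanishing function on a square has a single continuous logarithm, so both ways along the
boundary of the square from `(0, 0)` to `(1, 1)` give the same change. -/
theorem logChange_square {F : ℝ × ℝ → ℂ} (hF : Continuous F) (h0 : ∀ x, F x ≠ 0) :
    logChange (fun s => F (s, 0)) + logChange (fun t => F (1, t)) =
      logChange (fun t => F (0, t)) + logChange (fun s => F (s, 1)) := by
  obtain ⟨L, hL, h⟩ := exists_continuous_log hF h0
  rw [logChange_eq (L := fun s => L (s, 0)) (by fun_prop) fun x => h _,
    logChange_eq (L := fun s => L (1, s)) (by fun_prop) fun x => h _,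
    logChange_eq (L := fun s => L (0, s)) (by fun_prop) fun x => h _,
    logChange_eq (L := fun s => L (s, 1)) (by fun_prop) fun x => h _]
  ring

/-! ### Nonplanarity of `K₃,₃` -/

/-- Each of the integers `kA c a b` and `kB d a b` that are involved occurs in exactly two of the 18
equations, one for each pair of disjoint edges of `K₃,₃`, so the left-hand sides have an even sum,
whereas nine of the right-hand sides are `-1`. -/
theorem parity_obstruction (kA kB : Fin 3 → Fin 3 → Fin 3 → ℤ)
    (h1 : ∀ a c b d : Fin 3, a < c → b < d →
      kA c a b - kA a c d - kB d a b + kB b c d = -1)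
    (h2 : ∀ a c b d : Fin 3, a < c → d < b →
      kA c a b - kA a c d - kB d a b + kB b c d = 0) : False := by
  have e1 := h1 0 1 0 1 (by decide) (by decide)
  have e2 := h1 0 1 0 2 (by decide) (by decide)
  have e3 := h1 0 1 1 2 (by decide) (by decide)
  have e4 := h1 0 2 0 1 (by decide) (by decide)
  have e5 := h1 0 2 0 2 (by decide) (by decide)
  have e6 := h1 0 2 1 2 (by decide) (by decide)
  have e7 := h1 1 2 0 1 (by decide) (by decide)
  have e8 := h1 1 2 0 2 (by decide) (by decide)
  have e9 := h1 1 2 1 2 (by decide) (by decide)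
  have f1 := h2 0 1 1 0 (by decide) (by decide)
  have f2 := h2 0 1 2 0 (by decide) (by decide)
  have f3 := h2 0 1 2 1 (by decide) (by decide)
  have f4 := h2 0 2 1 0 (by decide) (by decide)
  have f5 := h2 0 2 2 0 (by decide) (by decide)
  have f6 := h2 0 2 2 1 (by decide) (by decide)
  have f7 := h2 1 2 1 0 (by decide) (by decide)
  have f8 := h2 1 2 2 0 (by decide) (by decide)
  have f9 := h2 1 2 2 1 (by decide) (by decide)
  omega

/-- There are no nine curves in the plane joining each of three points `A a` to each of three points
`B b` such that curves without a common endpoint are disjoint. Curves with a common endpoint may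
meet arbitrarily. -/
theorem no_K33_curves (A B : Fin 3 → ℂ) (γ : Fin 3 → Fin 3 → ℝ → ℂ)
    (hγ : ∀ a b, Continuous (γ a b)) (hA : ∀ a b, γ a b 0 = A a) (hB : ∀ a b, γ a b 1 = B b)
    (hdis : ∀ a b c d, a ≠ c → b ≠ d → ∀ s t, γ a b s ≠ γ c d t) : False := by
  have other : ∀ b : Fin 3, ∃ d, b ≠ d := by decide
  have hAA : ∀ a c, a ≠ c → A a - A c ≠ 0 := fun a c h => by
    have := hdis a 0 c 1 h (by decide) 0 0
    rwa [hA, hA, ← sub_ne_zero] at this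
  have hBB : ∀ b d, b ≠ d → B b - B d ≠ 0 := fun b d h => by
    have := hdis 0 b 1 d (by decide) h 1 1
    rwa [hB, hB, ← sub_ne_zero] at this
  have hBA : ∀ a b, B b - A a ≠ 0 := fun a b => by
    obtain ⟨c, hc⟩ := other a
    obtain ⟨d, hd⟩ := other b
    have := hdis c b a d hc.symm hd 1 0
    rwa [hB, hA, ← sub_ne_zero] at this
  -- Logarithms of the differences of the six points, antisymmetric up to `πi`.
  let π' : ℂ := Real.pi * Complex.I
  let LA : Fin 3 → Fin 3 → ℂ := fun a c =>
    if a < c then Complex.log (A a - A c) else Complex.log (A c - A a) + π'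
  let LB : Fin 3 → Fin 3 → ℂ := fun b d =>
    if b < d then Complex.log (B b - B d) else Complex.log (B d - B b) + π'
  have hLA : ∀ a c, a ≠ c → Complex.exp (LA a c) = A a - A c := fun a c h => by
    by_cases h' : a < c
    · simp only [LA, if_pos h', Complex.exp_log (hAA a c h)]
    · simp only [LA, if_neg h', π', Complex.exp_add, Complex.exp_log (hAA c a h.symm),
        Complex.exp_pi_mul_I]
      ring
  have hLB : ∀ a c, a ≠ c → Complex.exp (LB a c) = B a - B c := fun a c h => by
    by_cases h' : a < c
    · simp only [LB, if_pos h', Complex.exp_log (hBB a c h)]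
    · simp only [LB, if_neg h', π', Complex.exp_add, Complex.exp_log (hBB c a h.symm),
        Complex.exp_pi_mul_I]
      ring
  let LAB : Fin 3 → Fin 3 → ℂ := fun a b => Complex.log (B b - A a)
  have hLAB : ∀ a b, Complex.exp (LAB a b) = B b - A a := fun a b => Complex.exp_log (hBA a b)
  -- The change of the logarithm along an edge, seen from a vertex off that edge.
  have hkA : ∀ c a b, ∃ k : ℤ, a ≠ c →
      logChange (fun s => γ a b s - A c) = LAB c b - LA a c + k * (2 * π') := fun c a b => by
    by_cases h : a = c
    · exact ⟨0, fun h' => absurd h h'⟩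
    obtain ⟨d, hd⟩ := other b
    have h0 : ∀ s, γ a b s - A c ≠ 0 := fun s => by
      rw [← hA c d]; exact sub_ne_zero.2 (hdis a b c d h hd s 0)
    have hc : Continuous fun s => γ a b s - A c := (hγ a b).sub continuous_const
    obtain ⟨k, hk⟩ := exists_logChange_eq hc h0 (a := LA a c) (b := LAB c b)
      (by rw [hLA a c h, hA]) (by rw [hLAB, hB])
    exact ⟨k, fun _ => by rw [hk]; simp only [π']; ring⟩
  have hkB : ∀ d a b, ∃ k : ℤ, b ≠ d →
      logChange (fun s => γ a b s - B d) = LB b d - (LAB a d + π') + k * (2 * π') :=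
      fun d a b => by
    by_cases h : b = d
    · exact ⟨0, fun h' => absurd h h'⟩
    obtain ⟨c, hd⟩ := other a
    have h0 : ∀ s, γ a b s - B d ≠ 0 := fun s => by
      rw [← hB c d]; exact sub_ne_zero.2 (hdis a b c d hd h s 1)
    have hc : Continuous fun s => γ a b s - B d := (hγ a b).sub continuous_const
    obtain ⟨k, hk⟩ := exists_logChange_eq hc h0 (a := LAB a d + π') (b := LB b d)
      (by rw [Complex.exp_add, hLAB, hA, Complex.exp_pi_mul_I]; ring) (by rw [hLB b d h, hB])
    exact ⟨k, fun _ => by rw [hk]; simp only [π']; ring⟩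
  choose kA hkA using hkA
  choose kB hkB using hkB
  -- For disjoint edges `γ a b`, `γ c d` the function `γ a b s - γ c d t` has no zero in the square.
  have hsq : ∀ a c b d, a ≠ c → b ≠ d →
      LA c a - LA a c + LB d b - LB b d +
        (kA c a b - kA a c d - kB d a b + kB b c d : ℤ) * (2 * π') = 0 := by
    intro a c b d hac hbd
    have h0 : ∀ x : ℝ × ℝ, γ a b x.1 - γ c d x.2 ≠ 0 := fun x =>
      sub_ne_zero.2 (hdis a b c d hac hbd _ _)
    have hF : Continuous fun x : ℝ × ℝ => γ a b x.1 - γ c d x.2 :=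
      ((hγ a b).comp continuous_fst).sub ((hγ c d).comp continuous_snd)
    have h := logChange_square hF h0
    simp only [hA, hB] at h
    have n1 : logChange (fun t => B b - γ c d t) = logChange (fun t => γ c d t - B b) := by
      rw [← logChange_neg]
      · simp
      · exact continuous_const.sub (hγ c d)
      · intro t; simpa only [hB] using h0 (1, t)
    have n2 : logChange (fun t => A a - γ c d t) = logChange (fun t => γ c d t - A a) := by
      rw [← logChange_neg]
      · simp
      · exact continuous_const.sub (hγ c d)
      · intro t; simpa only [hA] using h0 (0, t)
    rw [n1, n2, hkA c a b hac, hkB b c d hbd.symm, hkA a c d hac.symm, hkB d a b hbd] at h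
    push_cast
    linear_combination h
  have hπ : π' ≠ 0 := by simp [π', Real.pi_ne_zero]
  refine parity_obstruction kA kB (fun a c b d hac hbd => ?_) (fun a c b d hac hbd => ?_)
  · have h := hsq a c b d hac.ne hbd.ne
    have : ((kA c a b - kA a c d - kB d a b + kB b c d : ℤ) : ℂ) = (-1 : ℤ) := by
      simp only [LA, LB, if_pos hac, if_pos hbd, if_neg hac.asymm, if_neg hbd.asymm] at h
      have h2 : (2 * π') * (((kA c a b - kA a c d - kB d a b + kB b c d : ℤ) : ℂ) + 1) = 0 := by
        linear_combination h
      rcases mul_eq_zero.1 h2 with h3 | h3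
      · simp [hπ] at h3
      · rw [eq_neg_of_add_eq_zero_left h3]; simp
    exact_mod_cast this
  · have h := hsq a c b d hac.ne hbd.ne'
    have : ((kA c a b - kA a c d - kB d a b + kB b c d : ℤ) : ℂ) = (0 : ℤ) := by
      simp only [LA, LB, if_pos hac, if_pos hbd, if_neg hac.asymm, if_neg hbd.asymm] at h
      have h2 : (2 * π') * (((kA c a b - kA a c d - kB d a b + kB b c d : ℤ) : ℂ)) = 0 := by
        linear_combination h
      rcases mul_eq_zero.1 h2 with h3 | h3
      · simp [hπ] at h3
      · rw [h3]; simp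
    exact_mod_cast this

/-- A planar graph has no `K₃,₃` drawn in it by walks: `A a` and `B b` are joined by a walk inside
`S a b`, and only sets `S a b`, `S c d` with `a = c` or `b = d` may overlap. -/
theorem IsPlanar.no_K33 {V : Type*} {G : SimpleGraph V} (hG : IsPlanar G) (A B : Fin 3 → V)
    (S : Fin 3 → Fin 3 → Set V)
    (hwalk : ∀ a b, ∃ w : G.Walk (A a) (B b), ∀ x ∈ w.support, x ∈ S a b)
    (hdis : ∀ a b c d, a ≠ c → b ≠ d → Disjoint (S a b) (S c d)) : False := by
  obtain ⟨pt, arc, hinj, harc, hvert, hcross⟩ := hG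
  -- The part of the drawing that belongs to a vertex set.
  let draw : Set V → Set (ℝ × ℝ) := fun S =>
    {q | (∃ x ∈ S, q = pt x) ∨ ∃ e ∈ G.edgeSet, (∀ x ∈ e, x ∈ S) ∧ q ∈ arc e}
  have hdraw : ∀ S T : Set V, Disjoint S T → ∀ p ∈ draw S, ∀ q ∈ draw T, p ≠ q := by
    rintro S T hST p hp q hq rfl
    have hne : ∀ z, z ∈ S → z ∈ T → False := fun z h1 h2 => Set.disjoint_left.1 hST h1 h2
    rcases hp with ⟨x, hx, rfl⟩ | ⟨e, he, heS, hpe⟩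
    · rcases hq with ⟨y, hy, hxy⟩ | ⟨e', he', heT, hqe⟩
      · exact hne x hx (hinj hxy ▸ hy)
      · exact hne x hx (heT x (hvert e' he' x hqe))
    · rcases hq with ⟨y, hy, rfl⟩ | ⟨e', he', heT, hqe⟩
      · exact hne y (heS y (hvert e he y hpe)) hy
      · by_cases hee : e = e'
        · subst hee
          induction e with | _ u v =>
          exact hne u (heS u (Sym2.mem_mk_left u v)) (heT u (Sym2.mem_mk_left u v))
        · obtain ⟨w, hw, hw', -⟩ := hcross e he e' he' hee p ⟨hpe, hqe⟩
          exact hne w (heS w hw) (heT w hw')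
  have hpath : ∀ (S : Set V) (u v : V) (w : G.Walk u v), (∀ x ∈ w.support, x ∈ S) →
      ∃ γ : Path (pt u) (pt v), ∀ t, γ t ∈ draw S := by
    intro S u v w
    induction w with
    | nil =>
      intro h
      exact ⟨Path.refl _, fun t => Or.inl ⟨_, h _ (by simp), rfl⟩⟩
    | @cons u v z hadj w ih =>
      intro h
      obtain ⟨γ', hγ'⟩ := ih fun x hx => h x (by simp [hx])
      obtain ⟨γ, -, hγ⟩ := harc u v hadj
      refine ⟨γ.trans γ', fun t => ?_⟩
      have : γ.trans γ' t ∈ Set.range (γ.trans γ') := ⟨t, rfl⟩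
      rw [Path.trans_range] at this
      rcases this with h1 | ⟨t', h1⟩
      · refine Or.inr ⟨s(u, v), hadj, fun x hx => ?_, hγ ▸ h1⟩
        rcases Sym2.mem_iff.1 hx with rfl | rfl
        · exact h _ (by simp)
        · exact h _ (by simp)
      · rw [← h1]; exact hγ' t'
  have h9 : ∀ a b, ∃ γ : Path (pt (A a)) (pt (B b)), ∀ t, γ t ∈ draw (S a b) := fun a b => by
    obtain ⟨w, hw⟩ := hwalk a b
    exact hpath _ _ _ w hw
  choose γ hγ using h9
  let e := Complex.equivRealProdCLM.symm
  refine no_K33_curves (fun a => e (pt (A a))) (fun b => e (pt (B b)))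
    (fun a b s => e ((γ a b).extend s)) (fun a b => e.continuous.comp (γ a b).continuous_extend)
    (fun a b => by simp) (fun a b => by simp) (fun a b c d hac hbd s t h => ?_)
  have h' := e.injective h
  have hmem : ∀ a b s, (γ a b).extend s ∈ draw (S a b) := fun a b s => by
    have : (γ a b).extend s ∈ Set.range (γ a b).extend := ⟨s, rfl⟩
    rw [Path.extend_range] at this
    obtain ⟨t, ht⟩ := this
    rw [← ht]; exact hγ a b t
  exact hdraw _ _ (hdis a b c d hac hbd) _ (hmem a b s) _ (hmem c d t) h'

/-! ### Noncrossing maps between cycles -/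

/-- A sequence `q : ℤ → ℤ/n`, thought of as a map from a cycle of length `N` to a cycle of length
`n`, is noncrossing if the preimages of two disjoint adjacent arcs `[a, b]` and `[b + 1, c]` never
alternate around the cycle of length `N`. -/
def Noncrossing (n N : ℕ) (q : ℤ → ZMod n) : Prop :=
  ∀ a b c : ℤ, a ≤ b → b < c → c < a + n → ∀ x₁ y₁ x₂ y₂ : ℤ,
    x₁ < y₁ → y₁ < x₂ → x₂ < y₂ → y₂ < x₁ + N →
    (∃ i, a ≤ i ∧ i ≤ b ∧ q x₁ = i) → (∃ i, b < i ∧ i ≤ c ∧ q y₁ = i) →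
    (∃ i, a ≤ i ∧ i ≤ b ∧ q x₂ = i) → (∃ i, b < i ∧ i ≤ c ∧ q y₂ = i) → False

theorem Noncrossing.comp_neg {n N : ℕ} {q : ℤ → ZMod n} (h : Noncrossing n N q)
    (hper : Function.Periodic q N) : Noncrossing n N (fun x => q (-x)) := by
  rintro a b c hab hbc hc x₁ y₁ x₂ y₂ h1 h2 h3 h4 hx₁ hy₁ hx₂ ⟨i, hi1, hi2, hi⟩
  exact h a b c hab hbc hc (-x₂) (-y₁) (-x₁) (-y₂ + N) (by omega) (by omega) (by omega) (by omega)
    hx₂ hy₁ hx₁ ⟨i, hi1, hi2, (hper _).trans hi⟩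

theorem exists_int_antidifference (d : ℤ → ℤ) : ∃ A : ℤ → ℤ, ∀ x, A (x + 1) = A x + d x := by
  refine ⟨fun x => ∑ j ∈ Finset.Ico 0 x, d j - ∑ j ∈ Finset.Ico x 0, d j, fun x => ?_⟩
  beta_reduce
  rcases le_or_gt 0 x with h | h
  · have : Finset.Ico 0 (x + 1) = insert x (Finset.Ico 0 x) := by
      ext y; simp; omega
    rw [this, Finset.sum_insert (by simp), Finset.Ico_eq_empty_of_le (a := x) h,
      Finset.Ico_eq_empty_of_le (a := x + 1) (by omega)]
    ring
  · have : Finset.Ico x 0 = insert x (Finset.Ico (x + 1) 0) := by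
      ext y; simp; omega
    rw [this, Finset.sum_insert (by simp), Finset.Ico_eq_empty_of_le (a := (0 : ℤ)) (b := x) h.le,
      Finset.Ico_eq_empty_of_le (a := (0 : ℤ)) (b := x + 1) (by omega)]
    ring

theorem eq_of_intCast_eq_of_abs_sub_lt {n : ℕ} {a b : ℤ} (h : (a : ZMod n) = b)
    (hab : |b - a| < n) : a = b := by
  rw [ZMod.intCast_eq_intCast_iff_dvd_sub] at h
  have := Int.eq_zero_of_abs_lt_dvd h hab
  omega

section Lift

variable {n N : ℕ} {q : ℤ → ZMod n}

theorem exists_mem_period (hN : 0 < N) (hper : Function.Periodic q N)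
    (hsurj : Function.Surjective q) (i : ZMod n) (x : ℤ) : ∃ y, x ≤ y ∧ y < x + N ∧ q y = i := by
  obtain ⟨y, rfl⟩ := hsurj i
  obtain ⟨z, hz, h⟩ := hper.exists_mem_Ico (by exact_mod_cast hN) y x
  exact ⟨z, hz.1, hz.2, h.symm⟩

/-- A noncrossing surjection between cycles moves by at most one at each step. After a longer step,
the points right after each of its two ends would still have to be attained, and two adjacent arcs,
chosen according to the order in which this happens, would alternate. -/
theorem Noncrossing.step (hn : 3 ≤ n) (hN : 0 < N) (hper : Function.Periodic q N)
    (hsurj : Function.Surjective q) (hq : Noncrossing n N q) (x : ℤ) :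
    ∃ d : ℤ, -1 ≤ d ∧ d ≤ 1 ∧ q (x + 1) = q x + d := by
  have : NeZero n := ⟨by omega⟩
  obtain ⟨u, hu⟩ := ZMod.intCast_surjective (q x)
  obtain ⟨m, hm, hmn⟩ : ∃ m : ℕ, q (x + 1) = q x + m ∧ m < n :=
    ⟨(q (x + 1) - q x).val, by simp, ZMod.val_lt _⟩
  by_contra hcon
  have h0 : m ≠ 0 := fun h => hcon ⟨0, by omega, by omega, by rw [hm, h]; simp⟩
  have h1 : m ≠ 1 := fun h => hcon ⟨1, by omega, by omega, by rw [hm, h]; simp⟩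
  have h2 : m + 1 ≠ n := fun h => hcon ⟨-1, by omega, by omega, by
    have : ((m + 1 : ℕ) : ZMod n) = 0 := by rw [h]; simp
    push_cast at this
    rw [hm, eq_neg_of_add_eq_zero_left this]; simp⟩
  have hw : q (x + 1) = ((u + m : ℤ) : ZMod n) := by rw [hm, ← hu]; push_cast; rfl
  obtain ⟨y, hy1, hy2, hy⟩ := exists_mem_period hN hper hsurj ((u + 1 : ℤ) : ZMod n) x
  obtain ⟨z, hz1, hz2, hz⟩ := exists_mem_period hN hper hsurj ((u + m + 1 : ℤ) : ZMod n) x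
  have key : ∀ a b : ℤ, a ≠ b → |b - a| < n → (a : ZMod n) ≠ b := fun a b hab h h' =>
    hab (eq_of_intCast_eq_of_abs_sub_lt h' h)
  have ne1 : y ≠ x := by
    rintro rfl; exact key u (u + 1) (by omega) (by rw [abs_lt]; omega) (hu.trans hy)
  have ne2 : y ≠ x + 1 := by
    rintro rfl; exact key (u + m) (u + 1) (by omega) (by rw [abs_lt]; omega) (hw.symm.trans hy)
  have ne3 : z ≠ x := by
    rintro rfl; exact key u (u + m + 1) (by omega) (by rw [abs_lt]; omega) (hu.trans hz)
  have ne4 : z ≠ x + 1 := by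
    rintro rfl
    exact key (u + m) (u + m + 1) (by omega) (by rw [abs_lt]; omega) (hw.symm.trans hz)
  have ne5 : y ≠ z := by
    rintro rfl; exact key (u + 1) (u + m + 1) (by omega) (by rw [abs_lt]; omega) (hy.symm.trans hz)
  rcases lt_or_gt_of_ne ne5 with h | h
  · exact hq u (u + m - 1) (u + n - 1) (by omega) (by omega) (by omega) x (x + 1) y z (by omega)
      (by omega) (by omega) (by omega) ⟨u, by omega, by omega, hu.symm⟩
      ⟨u + m, by omega, by omega, hw⟩ ⟨u + 1, by omega, by omega, hy⟩
      ⟨u + m + 1, by omega, by omega, hz⟩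
  · exact hq (u + m + 1) (u + n) (u + n + m) (by omega) (by omega) (by omega) x (x + 1) z y
      (by omega) (by omega) (by omega) (by omega) ⟨u + n, by omega, by omega, by simp [hu]⟩
      ⟨u + m + n, by omega, by omega, by simp [hw]⟩ ⟨u + m + 1, by omega, by omega, hz⟩
      ⟨u + 1 + n, by omega, by omega, by simp [hy]⟩

/-- A noncrossing map between cycles cannot first step forward and later step back. -/
theorem Noncrossing.not_up_down (hn : 3 ≤ n) (hN : 0 < N) (hper : Function.Periodic q N)
    (hsurj : Function.Surjective q) (hq : Noncrossing n N q) {d : ℤ → ℤ}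
    (hd : ∀ x, -1 ≤ d x ∧ d x ≤ 1) (hqd : ∀ x, q (x + 1) = q x + d x)
    (hdper : Function.Periodic d N) (x : ℤ) (k : ℕ) (hx : d x = 1) (hy : d (x + k) = -1) :
    False := by
  classical
  have hex : ∃ k : ℕ, ∃ x, d x = 1 ∧ d (x + k) = -1 := ⟨k, x, hx, hy⟩
  clear hx hy x k
  -- A forward step and a later backward step at minimal distance, so with no step in between.
  set k := Nat.find hex with hk
  obtain ⟨x, hx, hy⟩ := Nat.find_spec hex
  rw [← hk] at hy
  have hmid : ∀ j : ℕ, 0 < j → j < k → d (x + j) = 0 := by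
    intro j hj hjk
    have h1 : d (x + j) ≠ 1 := fun h => Nat.find_min hex (m := k - j) (by omega)
      ⟨x + j, h, by rw [← hy]; congr 1; omega⟩
    have h2 : d (x + j) ≠ -1 := fun h => Nat.find_min hex hjk ⟨x, hx, h⟩
    have := hd (x + j)
    omega
  have hk0 : k ≠ 0 := fun h => by rw [h] at hy; simp [hx] at hy
  have hdN : d (x + N) = 1 := by rw [hdper x, hx]
  have hkN : k < N := by
    by_contra h
    rcases eq_or_lt_of_le (not_lt.1 h) with h | h
    · rw [h, hy] at hdN; omega
    · have := hmid N hN h; omega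
  have hconst : ∀ j : ℕ, 1 ≤ j → j ≤ k → q (x + j) = q x + 1 := by
    intro j hj
    induction j, hj using Nat.le_induction with
    | base => intro _; have := hqd x; rw [hx] at this; simpa using this
    | succ j hj ih =>
      intro hjk
      have := hqd (x + j)
      rw [hmid j (by omega) (by omega), ih (by omega)] at this
      rw [Nat.cast_succ, ← add_assoc, this]; simp
  have hback : q (x + k + 1) = q x := by
    rw [hqd, hy, hconst k (by omega) le_rfl]; simp
  obtain ⟨u, hu⟩ := ZMod.intCast_surjective (q x)
  have key : ∀ a b : ℤ, a ≠ b → |b - a| < n → (a : ZMod n) ≠ b := fun a b hab h h' =>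
    hab (eq_of_intCast_eq_of_abs_sub_lt h' h)
  obtain ⟨z, hz1, hz2, hz⟩ := exists_mem_period hN hper hsurj ((u + 2 : ℤ) : ZMod n) x
  have hzk : x + k + 1 < z := by
    by_contra h
    obtain ⟨j, rfl⟩ : ∃ j : ℕ, z = x + j := ⟨(z - x).toNat, by omega⟩
    rcases Nat.eq_zero_or_pos j with rfl | hj
    · simp only [Nat.cast_zero, add_zero] at hz
      exact key u (u + 2) (by omega) (by rw [abs_lt]; omega) (hu.trans hz)
    rcases le_or_gt j k with hjk | hjk
    · rw [hconst j hj hjk, ← hu] at hz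
      exact key (u + 1) (u + 2) (by omega) (by rw [abs_lt]; omega) (by rw [← hz]; simp)
    · have : (x + j : ℤ) = x + k + 1 := by omega
      rw [this, hback] at hz
      exact key u (u + 2) (by omega) (by rw [abs_lt]; omega) (hu.trans hz)
  have h1 := hconst 1 le_rfl (by omega)
  rw [Nat.cast_one] at h1
  exact hq u u (u + 2) le_rfl (by omega) (by omega) x (x + 1) (x + k + 1) z (by omega) (by omega)
    hzk hz2 ⟨u, le_rfl, le_rfl, hu.symm⟩ ⟨u + 1, by omega, by omega, by rw [h1, ← hu]; simp⟩
    ⟨u, le_rfl, le_rfl, by rw [hback, hu]⟩ ⟨u + 2, by omega, le_rfl, hz⟩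

/-- A noncrossing map that only steps forward lifts to a monotone surjection of `ℤ` of degree one:
winding around twice would produce the crossing pattern `u, u + 1, u, u + 1`. -/
theorem Noncrossing.exists_lift_of_forward (hn : 3 ≤ n) (hN : 0 < N)
    (hper : Function.Periodic q N) (hsurj : Function.Surjective q) (hq : Noncrossing n N q)
    {d : ℤ → ℤ} (hd : ∀ x, 0 ≤ d x ∧ d x ≤ 1) (hqd : ∀ x, q (x + 1) = q x + d x) :
    ∃ P : ℤ → ℤ, Monotone P ∧ Function.Surjective P ∧ (∀ x, P (x + N) = P x + n) ∧
      ∀ x, (P x : ZMod n) = q x := by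
  obtain ⟨u, hu⟩ := ZMod.intCast_surjective (q 0)
  obtain ⟨A, hA⟩ := exists_int_antidifference d
  set P : ℤ → ℤ := fun x => A x + (u - A 0) with hP
  have hP0 : P 0 = u := by simp [hP]
  have hstep : ∀ x, P (x + 1) = P x + d x := fun x => by simp only [hP, hA]; ring
  have hlift : ∀ x, (P x : ZMod n) = q x := by
    intro x
    induction x using Int.induction_on with
    | zero => rw [hP0, hu]
    | succ i ih => rw [hstep, hqd, ← ih]; simp
    | pred i ih =>
      have h1 := hstep (-i - 1)
      have h2 := hqd (-i - 1)
      rw [sub_add_cancel] at h1 h2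
      rw [h2, h1] at ih
      push_cast at ih
      exact add_right_cancel ih
  have hmono : Monotone P := monotone_int_of_le_succ fun x => by
    have := hstep x; have := hd x; omega
  have hdper : ∀ x, d (x + N) = d x := by
    intro x
    have h1 := hqd (x + N)
    have h2 : q (x + N + 1) = q (x + 1) := by rw [add_right_comm]; exact hper _
    rw [h2, hper x, hqd] at h1
    refine (eq_of_intCast_eq_of_abs_sub_lt (add_left_cancel h1) ?_).symm
    have := hd x; have := hd (x + N)
    rw [abs_lt]; omega
  obtain ⟨D, hD⟩ : ∃ D, ∀ x, P (x + N) = P x + D := by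
    refine ⟨P N - P 0, fun x => ?_⟩
    induction x using Int.induction_on with
    | zero => simp
    | succ i ih => rw [add_right_comm, hstep, ih, hstep, hdper]; ring
    | pred i ih =>
      have h1 := hstep (-i - 1)
      have h2 := hstep (-i - 1 + N)
      rw [hdper, add_right_comm] at h2
      rw [sub_add_cancel] at h1 h2
      omega
  have hDn : (n : ℤ) ∣ D := by
    have h1 := hlift (0 + N)
    rw [hD, hper, ← hlift 0] at h1
    rw [← ZMod.intCast_zmod_eq_zero_iff_dvd]
    · push_cast at h1; exact add_eq_left.1 h1
  obtain ⟨k, hk⟩ := hDn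
  have hDpos : 0 < D := by
    by_contra h
    obtain ⟨y, hy1, hy2, hy⟩ := exists_mem_period hN hper hsurj ((u + 1 : ℤ) : ZMod n) 0
    have h1 := hmono hy1
    have h2 := hmono hy2.le
    rw [hD, hP0] at h2
    rw [hP0] at h1
    have h3 : P y = u := by omega
    rw [← hlift, h3] at hy
    have := eq_of_intCast_eq_of_abs_sub_lt hy (by rw [abs_lt]; omega)
    omega
  have hmul : ∀ m : ℕ, P (m * N) = u + m * D ∧ P (-(m * N)) = u - m * D := by
    intro m
    induction m with
    | zero => simp [hP0]
    | succ m ih =>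
      refine ⟨?_, ?_⟩
      · have : ((m + 1 : ℕ) : ℤ) * N = m * N + N := by push_cast; ring
        rw [this, hD, ih.1]; push_cast; ring
      · have h1 := hD (-(((m + 1 : ℕ) : ℤ) * N))
        have : -(((m + 1 : ℕ) : ℤ) * N) + N = -(m * N) := by push_cast; ring
        rw [this, ih.2] at h1
        have h3 : ((m + 1 : ℕ) : ℤ) * D = m * D + D := by push_cast; ring
        rw [h3]; omega
  have hPsurj : Function.Surjective P := by
    intro v
    obtain ⟨y, hy, hmin⟩ := Int.exists_least_of_bdd (P := fun y => v ≤ P y)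
      ⟨-((v - u - 1).natAbs * N), fun z hz => by
        by_contra hlt
        have h1 := hmono (not_le.1 hlt).le
        rw [(hmul _).2] at h1
        have : (((v - u - 1).natAbs : ℤ)) ≤ (v - u - 1).natAbs * D :=
          le_mul_of_one_le_right (by positivity) (by omega)
        omega⟩
      ⟨(v - u).natAbs * N, by
        rw [(hmul _).1]
        have : (((v - u).natAbs : ℤ)) ≤ (v - u).natAbs * D :=
          le_mul_of_one_le_right (by positivity) (by omega)
        omega⟩
    refine ⟨y, ?_⟩
    by_contra hne
    have h1 := hstep (y - 1)
    have h2 := hd (y - 1)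
    rw [sub_add_cancel] at h1
    have := hmin (y - 1) (by omega)
    omega
  refine ⟨P, hmono, hPsurj, fun x => ?_, hlift⟩
  rw [hD]
  congr 1
  have hn0 : (0 : ℤ) < n := by omega
  have hk1 : 1 ≤ k := by
    have : 0 < k := by rw [hk] at hDpos; exact pos_of_mul_pos_right hDpos hn0.le
    omega
  rcases eq_or_lt_of_le hk1 with h | h
  · rw [hk, ← h, mul_one]
  exfalso
  have h2n : 2 * (n : ℤ) ≤ D := by rw [hk]; nlinarith
  obtain ⟨y₁, hy₁⟩ := hPsurj (u + 1)
  obtain ⟨x₂, hx₂⟩ := hPsurj (u + n)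
  obtain ⟨y₂, hy₂⟩ := hPsurj (u + n + 1)
  refine hq u u (u + 1) le_rfl (by omega) (by omega) 0 y₁ x₂ y₂ (hmono.reflect_lt (by omega))
    (hmono.reflect_lt (by omega)) (hmono.reflect_lt (by omega))
    (hmono.reflect_lt (by rw [hD]; omega)) ⟨u, le_rfl, le_rfl, hu.symm⟩
    ⟨u + 1, by omega, le_rfl, by rw [← hlift, hy₁]⟩
    ⟨u, le_rfl, le_rfl, by rw [← hlift, hx₂]; simp⟩
    ⟨u + 1, by omega, le_rfl, by rw [← hlift, hy₂]; simp⟩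

/-- A noncrossing surjection between cycles lifts, up to reversing the orientation, to a monotone
surjection of `ℤ` of degree one. -/
theorem Noncrossing.exists_lift (hn : 3 ≤ n) (hN : 0 < N)
    (hper : Function.Periodic q N) (hsurj : Function.Surjective q) (hq : Noncrossing n N q) :
    ∃ ε : ℤ, (ε = 1 ∨ ε = -1) ∧
    ∃ P : ℤ → ℤ, Monotone P ∧ Function.Surjective P ∧ (∀ x, P (x + N) = P x + n) ∧
      ∀ x, (P x : ZMod n) = q (ε * x) := by
  choose d hd1 hd2 hqd using hq.step hn hN hper hsurj
  have hdper : Function.Periodic d N := by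
    intro x
    have h1 := hqd (x + N)
    have h2 : q (x + N + 1) = q (x + 1) := by rw [add_right_comm]; exact hper _
    rw [h2, hper x, hqd] at h1
    refine (eq_of_intCast_eq_of_abs_sub_lt (add_left_cancel h1) ?_).symm
    have := hd1 x; have := hd1 (x + N); have := hd2 x; have := hd2 (x + N)
    rw [abs_lt]; omega
  by_cases hup : ∃ x, d x = 1
  · obtain ⟨x, hx⟩ := hup
    refine ⟨1, Or.inl rfl, ?_⟩
    simp only [one_mul]
    refine hq.exists_lift_of_forward hn hN hper hsurj (d := d) (fun y => ⟨?_, hd2 y⟩) hqd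
    by_contra hy
    have hy' : d y = -1 := by have := hd1 y; omega
    obtain ⟨z, hz, hyz⟩ := hdper.exists_mem_Ico (by exact_mod_cast hN) y x
    obtain ⟨k, rfl⟩ : ∃ k : ℕ, z = x + k := ⟨(z - x).toNat, by have := hz.1; omega⟩
    exact hq.not_up_down hn hN hper hsurj (fun x => ⟨hd1 x, hd2 x⟩) hqd hdper x k hx
      (hyz ▸ hy')
  · push Not at hup
    refine ⟨-1, Or.inr rfl, ?_⟩
    simp only [neg_mul, one_mul]
    refine (hq.comp_neg hper).exists_lift_of_forward hn hN ?_ (hsurj.comp neg_surjective)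
      (d := fun x => -d (-x - 1)) (fun y => ?_) fun x => ?_
    · intro x
      have := hper (-(x + N))
      beta_reduce
      rw [← this]; congr 1; ring
    · have := hd1 (-y - 1); have := hd2 (-y - 1); have := hup (-y - 1)
      constructor <;> omega
    · have := hqd (-x - 1)
      rw [sub_add_cancel] at this
      rw [this, neg_add']; simp

end Lift

/-! ### Cyclic coordinates on a funnel -/

/-- Cyclic coordinates on a layered graph: `vtx i` lists the `i`-th layer, for `i < Δ`, as a
sequence of period `n i` that is injective modulo `n i`, and the parent of `vtx (i + 1) x` is
`vtx i (P i x)`, where `P i : ℤ → ℤ` is monotone of degree one. The sequences `n` and `P` are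
prolonged beyond `Δ` in an arbitrary way. -/
structure IsCyclicChart {V : Type*} (G : SimpleGraph V) (Δ : ℕ) (n : ℕ → ℕ) (vtx : ℕ → ℤ → V)
    (P : ℕ → ℤ → ℤ) : Prop where
  pos : 0 < Δ
  n_zero : n 0 = 1
  n_pos : ∀ i, 0 < n i
  mono : ∀ i, Monotone (P i)
  surj : ∀ i, Function.Surjective (P i)
  degree : ∀ i x, P i (x + n (i + 1)) = P i x + n i
  eq_iff : ∀ i < Δ, ∀ j < Δ, ∀ x y, vtx i x = vtx j y ↔ i = j ∧ (n i : ℤ) ∣ x - y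
  cover : ∀ y, ∃ i < Δ, ∃ x, vtx i x = y
  adj_succ : ∀ i < Δ, ∀ x, vtx i x = vtx i (x + 1) ∨ G.Adj (vtx i x) (vtx i (x + 1))
  adj_parent : ∀ i, i + 1 < Δ → ∀ x, G.Adj (vtx (i + 1) x) (vtx i (P i x))
  adj_cases : ∀ y z, G.Adj y z →
    (∃ i < Δ, ∃ x, (y = vtx i x ∧ z = vtx i (x + 1)) ∨ (z = vtx i x ∧ y = vtx i (x + 1))) ∨
    ∃ i, i + 1 < Δ ∧ ∃ x, (y = vtx (i + 1) x ∧ z = vtx i (P i x)) ∨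
      (z = vtx (i + 1) x ∧ y = vtx i (P i x))

section Cycle

variable {V : Type*} {G : SimpleGraph V} {n : ℕ}

/-- The vertices of an embedded cycle, listed periodically. -/
def cycleVertex [NeZero n] (C : SimpleGraph.cycleGraph n ↪g G) (x : ℤ) : V :=
  C ⟨(x % n).toNat, by
    have h0 : (n : ℤ) ≠ 0 := by exact_mod_cast NeZero.ne n
    have h1 := Int.emod_nonneg x h0
    have h2 := Int.emod_lt_of_pos x (b := (n : ℤ)) (by have := Nat.pos_of_neZero n; omega)
    omega⟩

variable [NeZero n] (C : SimpleGraph.cycleGraph n ↪g G)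

theorem cycleVertex_val_mod (x : ℤ) : (((x % n).toNat : ℕ) : ℤ) = x % n :=
  Int.toNat_of_nonneg (Int.emod_nonneg x (by exact_mod_cast NeZero.ne n))

theorem cycleVertex_eq_iff (x y : ℤ) :
    cycleVertex C x = cycleVertex C y ↔ (n : ℤ) ∣ x - y := by
  rw [cycleVertex, cycleVertex, C.injective.eq_iff, Fin.mk.injEq, ← Int.natCast_inj,
    cycleVertex_val_mod, cycleVertex_val_mod, Int.emod_eq_emod_iff_emod_sub_eq_zero,
    Int.dvd_iff_emod_eq_zero]

theorem range_cycleVertex : Set.range (cycleVertex C) = Set.range C := by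
  ext y
  constructor
  · rintro ⟨x, rfl⟩; exact ⟨_, rfl⟩
  · rintro ⟨k, rfl⟩
    refine ⟨k.val, ?_⟩
    rw [cycleVertex]
    congr 1
    ext
    simp only
    rw [← Int.natCast_mod, Int.toNat_natCast, Nat.mod_eq_of_lt k.2]

theorem cycleVertex_adj_iff (x y : ℤ) : G.Adj (cycleVertex C x) (cycleVertex C y) ↔
    (x - y) % n = 1 ∨ (y - x) % n = 1 := by
  rw [cycleVertex, cycleVertex, C.map_adj_iff, SimpleGraph.cycleGraph_adj', ← Int.natCast_inj,
    ← Int.natCast_inj, Fin.coe_int_sub_eq_mod, Fin.coe_int_sub_eq_mod]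
  simp only [cycleVertex_val_mod, Nat.cast_one, ← Int.sub_emod]

theorem cycleVertex_succ (x : ℤ) : cycleVertex C x = cycleVertex C (x + 1) ∨
    G.Adj (cycleVertex C x) (cycleVertex C (x + 1)) := by
  rw [cycleVertex_eq_iff, cycleVertex_adj_iff]
  have := Nat.pos_of_neZero n
  rcases Nat.lt_or_ge 1 n with h | h
  · right; right
    rw [add_sub_cancel_left]
    exact Int.emod_eq_of_lt (by omega) (by omega)
  · left
    have : n = 1 := by omega
    subst this
    simp

theorem dvd_of_cycleVertex_adj {x y : ℤ} (h : G.Adj (cycleVertex C x) (cycleVertex C y)) :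
    (n : ℤ) ∣ x - (y + 1) ∨ (n : ℤ) ∣ y - (x + 1) := by
  rcases (cycleVertex_adj_iff C x y).1 h with h | h
  · left; rw [← sub_sub]; rw [← h]; exact Int.dvd_self_sub_emod
  · right; rw [← sub_sub]; rw [← h]; exact Int.dvd_self_sub_emod

theorem exists_walk_cycleVertex {a b : ℤ} (hab : a ≤ b) :
    ∃ w : G.Walk (cycleVertex C a) (cycleVertex C b),
      ∀ x ∈ w.support, x ∈ cycleVertex C '' Set.Icc a b := by
  induction b, hab using Int.leInduction with
  | base => exact ⟨.nil, fun x hx => ⟨a, by simp, by simpa using (by simpa using hx : x = _).symm⟩⟩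
  | succ b hab ih =>
    obtain ⟨w, hw⟩ := ih
    have hsub : cycleVertex C '' Set.Icc a b ⊆ cycleVertex C '' Set.Icc a (b + 1) :=
      Set.image_mono (Set.Icc_subset_Icc_right (by omega))
    rcases cycleVertex_succ C b with h | h
    · rw [← h]; exact ⟨w, fun x hx => hsub (hw x hx)⟩
    · refine ⟨w.concat h, fun x hx => ?_⟩
      rw [SimpleGraph.Walk.support_concat, List.mem_append] at hx
      rcases hx with hx | hx
      · exact hsub (hw x hx)
      · exact ⟨b + 1, ⟨by omega, le_rfl⟩, (by simpa using hx : x = _).symm⟩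

end Cycle

/-- In a planar graph the parent map between two disjoint cycles is noncrossing. If the children of
two adjacent arcs alternated around the outer cycle, then four alternating children, together with
the two neighbouring ends of the arcs, would span a `K₃,₃`. -/
theorem IsPlanar.noncrossing {V : Type*} {G : SimpleGraph V} (hG : IsPlanar G) {n N : ℕ}
    [NeZero n] [NeZero N] (C : SimpleGraph.cycleGraph n ↪g G) (C' : SimpleGraph.cycleGraph N ↪g G)
    (hdis : Disjoint (Set.range C) (Set.range C')) (q : ℤ → ZMod n)
    (hq : ∀ x (i : ℤ), q x = i → G.Adj (cycleVertex C' x) (cycleVertex C i)) :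
    Noncrossing n N q := by
  rintro a b c hab hbc hca x₁ y₁ x₂ y₂ h1 h2 h3 h4 ⟨i₁, hi1, hi1', hi1q⟩ ⟨j₁, hj1, hj1', hj1q⟩
    ⟨i₂, hi2, hi2', hi2q⟩ ⟨j₂, hj2, hj2', hj2q⟩
  rw [← range_cycleVertex, ← range_cycleVertex] at hdis
  set f := cycleVertex C with hf
  set g := cycleVertex C' with hg
  have hfg : ∀ s t : ℤ, f s ≠ g t := fun s t h =>
    Set.disjoint_left.1 hdis ⟨s, rfl⟩ ⟨t, h.symm⟩
  have hfne : ∀ s t : ℤ, s < t → t < s + n → f s ≠ f t := fun s t hst hts h => by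
    rw [hf, cycleVertex_eq_iff] at h
    have := Int.eq_zero_of_abs_lt_dvd h (by rw [abs_lt]; omega)
    omega
  have hgne : ∀ s t : ℤ, s < t → t < s + N → g s ≠ g t := fun s t hst hts h => by
    rw [hg, cycleVertex_eq_iff] at h
    have := Int.eq_zero_of_abs_lt_dvd h (by rw [abs_lt]; omega)
    omega
  have hgper : g (x₁ + N) = g x₁ := by rw [hg, cycleVertex_eq_iff]; simp
  -- Walks from the end of an arc to a child of the arc.
  have hA : ∀ x i, a ≤ i → i ≤ b → q x = i →
      ∃ w : G.Walk (g x) (f b), ∀ z ∈ w.support, z ∈ insert (g x) (f '' Set.Icc a b) := by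
    intro x i hai hib hqx
    obtain ⟨w, hw⟩ := exists_walk_cycleVertex C hib
    refine ⟨.cons (hq x i hqx) w, fun z hz => ?_⟩
    rw [SimpleGraph.Walk.support_cons, List.mem_cons] at hz
    rcases hz with rfl | hz
    · exact Or.inl rfl
    · exact Or.inr (Set.image_mono (Set.Icc_subset_Icc_left hai) (hw z hz))
  have hB : ∀ y i, b < i → i ≤ c → q y = i →
      ∃ w : G.Walk (f (b + 1)) (g y),
        ∀ z ∈ w.support, z ∈ insert (g y) (f '' Set.Icc (b + 1) c) := by
    intro y i hbi hic hqy
    obtain ⟨w, hw⟩ := exists_walk_cycleVertex C (show b + 1 ≤ i by omega)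
    refine ⟨w.concat (hq y i hqy).symm, fun z hz => ?_⟩
    rw [SimpleGraph.Walk.support_concat, List.mem_append] at hz
    rcases hz with hz | hz
    · exact Or.inr (Set.image_mono (Set.Icc_subset_Icc_right hic) (hw z hz))
    · exact Or.inl (by simpa using hz)
  have hC : ∃ w : G.Walk (f (b + 1)) (f b), ∀ z ∈ w.support, z ∈ f '' Set.Icc b (b + 1) := by
    obtain ⟨w, hw⟩ := exists_walk_cycleVertex C (show b ≤ b + 1 by omega)
    exact ⟨w.reverse, fun z hz => hw z (by simpa using hz)⟩
  let S : Fin 3 → Fin 3 → Set V := ![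
    ![g '' Set.Icc x₁ y₁, g '' Set.Icc y₂ (x₁ + N), insert (g x₁) (f '' Set.Icc a b)],
    ![g '' Set.Icc y₁ x₂, g '' Set.Icc x₂ y₂, insert (g x₂) (f '' Set.Icc a b)],
    ![insert (g y₁) (f '' Set.Icc (b + 1) c), insert (g y₂) (f '' Set.Icc (b + 1) c),
      f '' Set.Icc b (b + 1)]]
  have rev : ∀ {u v : V} {T : Set V}, (∃ w : G.Walk u v, ∀ z ∈ w.support, z ∈ T) →
      ∃ w : G.Walk v u, ∀ z ∈ w.support, z ∈ T := by
    rintro u v T ⟨w, hw⟩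
    exact ⟨w.reverse, fun z hz => hw z (by simpa using hz)⟩
  have dGG : ∀ s t s' t' : ℤ, t < s' → t' < s + N →
      Disjoint (g '' Set.Icc s t) (g '' Set.Icc s' t') := by
    intro s t s' t' h h'
    rw [Set.disjoint_left]
    rintro _ ⟨z, ⟨hz1, hz2⟩, rfl⟩ ⟨z', ⟨hz1', hz2'⟩, hzz⟩
    exact hgne z z' (by omega) (by omega) hzz.symm
  have dGF : ∀ s t s' t' : ℤ, Disjoint (g '' Set.Icc s t) (f '' Set.Icc s' t') := by
    intro s t s' t'
    rw [Set.disjoint_left]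
    rintro _ ⟨z, -, rfl⟩ ⟨z', -, hzz⟩
    exact hfg _ _ hzz
  have dGI : ∀ s t z s' t' : ℤ, t < z → z < s + N →
      Disjoint (g '' Set.Icc s t) (insert (g z) (f '' Set.Icc s' t')) := by
    intro s t z s' t' h h'
    rw [Set.disjoint_insert_right]
    refine ⟨?_, dGF _ _ _ _⟩
    rintro ⟨z', ⟨hz1, hz2⟩, hzz⟩
    exact hgne z' z (by omega) (by omega) hzz
  have dGI' : ∀ s t z s' t' : ℤ, z < s → t < z + N →
      Disjoint (g '' Set.Icc s t) (insert (g z) (f '' Set.Icc s' t')) := by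
    intro s t z s' t' h h'
    rw [Set.disjoint_insert_right]
    refine ⟨?_, dGF _ _ _ _⟩
    rintro ⟨z', ⟨hz1, hz2⟩, hzz⟩
    exact hgne z z' (by omega) (by omega) hzz.symm
  have dII : ∀ s t : ℤ, g s ≠ g t → Disjoint (insert (g s) (f '' Set.Icc a b))
      (insert (g t) (f '' Set.Icc (b + 1) c)) := by
    intro s t hst
    rw [Set.disjoint_left]
    rintro _ (rfl | ⟨z, ⟨hz1, hz2⟩, rfl⟩) (h | ⟨z', ⟨hz1', hz2'⟩, hzz⟩)
    · exact hst h
    · exact hfg _ _ hzz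
    · exact hfg _ _ h
    · exact hfne z z' (by omega) (by omega) hzz.symm
  refine hG.no_K33 ![g x₁, g x₂, f (b + 1)] ![g y₁, g y₂, f b] S ?_ ?_
  · intro i j
    fin_cases i <;> fin_cases j
    · exact exists_walk_cycleVertex C' h1.le
    · have := exists_walk_cycleVertex C' h4.le
      rw [← hg, hgper] at this
      exact rev this
    · exact hA _ _ hi1 hi1' hi1q
    · exact rev (exists_walk_cycleVertex C' h2.le)
    · exact exists_walk_cycleVertex C' h3.le
    · exact hA _ _ hi2 hi2' hi2q
    · exact hB _ _ hj1 hj1' hj1q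
    · exact hB _ _ hj2 hj2' hj2q
    · exact hC
  · -- It suffices to consider `i < k`.
    have main : ∀ i j k l : Fin 3, i < k → j ≠ l → Disjoint (S i j) (S k l) := by
      intro i j k l hik hjl
      fin_cases i <;> fin_cases k <;> first | exact absurd hik (by decide) | skip
      · fin_cases j <;> fin_cases l <;> first | exact absurd rfl hjl | skip
        · refine dGG _ _ _ _ ?_ ?_ <;> omega
        · refine dGI _ _ _ _ _ ?_ ?_ <;> omega
        · refine (dGG _ _ _ _ ?_ ?_).symm <;> omega
        · refine dGI' _ _ _ _ _ ?_ ?_ <;> omega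
        · refine (dGI' _ _ _ _ _ ?_ ?_).symm <;> omega
        · refine (dGI' _ _ _ _ _ ?_ ?_).symm <;> omega
      · fin_cases j <;> fin_cases l <;> first | exact absurd rfl hjl | skip
        · refine dGI _ _ _ _ _ ?_ ?_ <;> omega
        · exact dGF _ _ _ _
        · refine dGI' _ _ _ _ _ ?_ ?_ <;> omega
        · exact dGF _ _ _ _
        · exact dII _ _ (hgne _ _ (by omega) (by omega))
        · exact dII _ _ (hgne _ _ (by omega) (by omega))
      · fin_cases j <;> fin_cases l <;> first | exact absurd rfl hjl | skip
        · refine dGI _ _ _ _ _ ?_ ?_ <;> omega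
        · exact dGF _ _ _ _
        · refine dGI' _ _ _ _ _ ?_ ?_ <;> omega
        · exact dGF _ _ _ _
        · exact dII _ _ (hgne _ _ (by omega) (by omega)).symm
        · exact dII _ _ (hgne _ _ (by omega) (by omega))
    intro i j k l hik hjl
    rcases lt_or_gt_of_ne hik with h | h
    · exact main i j k l h hjl
    · exact (main k l i j h hjl.symm).symm

/-- A funnel has cyclic coordinates: the parent maps of consecutive layers are lifted one by one,
and the layers are then reversed where necessary to orient all of them consistently. -/
theorem IsFunnel.exists_isCyclicChart {V : Type*} {G : SimpleGraph V} (hG : IsFunnel G) :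
    ∃ Δ n vtx P, IsCyclicChart G Δ n vtx P := by
  obtain ⟨hpl, v, Δ, n, C, hn, hL⟩ := hG
  have hΔ : 0 < Δ := by
    have : v ∈ ⋃ i, Set.range (C i) := by rw [hL.cover]; trivial
    obtain ⟨i, -⟩ := Set.mem_iUnion.1 this
    exact i.pos
  have hpos : ∀ i, NeZero (n i) := fun i => ⟨by have := hn i; omega⟩
  let fin : ℕ → Fin Δ := fun i => ⟨min i (Δ - 1), by omega⟩
  have hfin : ∀ i < Δ, (fin i).val = i := fun i hi => by simp only [fin]; omega
  have hfin' : ∀ i : Fin Δ, fin i.val = i := fun i => by ext; exact hfin _ i.2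
  let N : ℕ → ℕ := fun i => n (fin i)
  have hNpos : ∀ i, 0 < N i := fun i => Nat.pos_of_neZero (n (fin i))
  let w : ℕ → ℤ → V := fun i => cycleVertex (C (fin i))
  have hrange : ∀ i, Set.range (w i) = Set.range (C (fin i)) := fun i => range_cycleVertex _
  have hcover : ∀ y, ∃ i < Δ, ∃ x, w i x = y := by
    intro y
    have : y ∈ ⋃ i, Set.range (C i) := by rw [hL.cover]; trivial
    obtain ⟨i, hi⟩ := Set.mem_iUnion.1 this
    have h : y ∈ Set.range (w i) := by rw [hrange, hfin']; exact hi
    exact ⟨i, i.2, h⟩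
  have hlayer : ∀ i < Δ, ∀ j < Δ, ∀ x y, w i x = w j y → i = j := by
    intro i hi j hj x y h
    by_contra hij
    have h1 : w i x ∈ Set.range (C (fin i)) := by rw [← hrange]; exact ⟨x, rfl⟩
    have h2 : w i x ∈ Set.range (C (fin j)) := by rw [← hrange, h]; exact ⟨y, rfl⟩
    have hdis : Disjoint (Set.range (C (fin i))) (Set.range (C (fin j))) :=
      hL.disjoint (fin i) (fin j) (fun h => hij (by rw [← hfin i hi, ← hfin j hj, h]))
    exact Set.disjoint_left.1 hdis h1 h2
  have hw : ∀ i x y, w i x = w i y ↔ (N i : ℤ) ∣ x - y := fun i x y => cycleVertex_eq_iff _ x y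
  have hparent : ∀ i, i + 1 < Δ → ∀ x, ∃ y, G.Adj (w (i + 1) x) (w i y) := by
    intro i hi x
    obtain ⟨y, ⟨hy, hxy⟩, -⟩ := hL.parent (fin i) (fin (i + 1))
      (by rw [hfin _ hi, hfin i (by omega)]) (w (i + 1) x) (by rw [← hrange]; exact ⟨x, rfl⟩)
    rw [← hrange] at hy
    obtain ⟨y, rfl⟩ := hy
    exact ⟨y, hxy⟩
  have hunique : ∀ i, i + 1 < Δ → ∀ x y z, G.Adj (w (i + 1) x) (w i y) →
      G.Adj (w (i + 1) x) (w i z) → w i y = w i z := by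
    intro i hi x y z hy hz
    refine (hL.parent (fin i) (fin (i + 1))
      (by rw [hfin _ hi, hfin i (by omega)]) (w (i + 1) x)
      (by rw [← hrange]; exact ⟨x, rfl⟩)).unique ⟨?_, hy⟩ ⟨?_, hz⟩
    all_goals rw [← hrange]; exact ⟨_, rfl⟩
  have hchild : ∀ i, i + 1 < Δ → ∀ y, ∃ x, G.Adj (w (i + 1) x) (w i y) := by
    intro i hi y
    obtain ⟨x, hx, hxy⟩ := hL.child (fin i) (fin (i + 1))
      (by rw [hfin _ hi, hfin i (by omega)]) (w i y) (by rw [← hrange]; exact ⟨y, rfl⟩)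
    rw [← hrange] at hx
    obtain ⟨x, rfl⟩ := hx
    exact ⟨x, hxy.symm⟩
  have hsep : ∀ i j x y, i < Δ → j < Δ → i + 1 < j → ¬ G.Adj (w i x) (w j y) := by
    intro i j x y hi hj hij
    refine (hL.separates (fin (i + 1)) (by rw [hfin _ (by omega)]; omega)
      (by rw [hfin _ (by omega)]; omega)).2.2 (fin i) (fin j) ?_ ?_ _ ?_ _ ?_
    · rw [Fin.lt_def, hfin _ (by omega), hfin _ (by omega)]; omega
    · rw [Fin.lt_def, hfin _ (by omega), hfin _ (by omega)]; omega
    · rw [← hrange]; exact ⟨_, rfl⟩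
    · rw [← hrange]; exact ⟨_, rfl⟩
  have hlift : ∀ i, ∃ ε : ℤ, (ε = 1 ∨ ε = -1) ∧ ∃ P : ℤ → ℤ, Monotone P ∧ Function.Surjective P ∧
      (∀ x, P (x + N (i + 1)) = P x + N i) ∧
      (i + 1 < Δ → ∀ x, G.Adj (w (i + 1) (ε * x)) (w i (P x))) := by
    intro i
    by_cases hi : i + 1 < Δ
    swap
    · refine ⟨1, Or.inl rfl, id, monotone_id, Function.surjective_id, fun x => ?_,
        fun h => absurd h hi⟩
      have : fin (i + 1) = fin i := by ext; simp only [fin]; omega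
      simp only [N, this, id]
    rcases hn (fin i) with h1 | h3
    · -- A single vertex: the layer below is wrapped around it once.
      have hN1 : N i = 1 := h1
      have hN' : (0 : ℤ) < N (i + 1) := by exact_mod_cast hNpos (i + 1)
      refine ⟨1, Or.inl rfl, fun x => x / N (i + 1), fun x y h => Int.ediv_le_ediv hN' h,
        fun y => ⟨y * N (i + 1), Int.mul_ediv_cancel _ hN'.ne'⟩, fun x => ?_, fun _ x => ?_⟩
      · beta_reduce
        rw [Int.add_ediv_of_dvd_right dvd_rfl, Int.ediv_self hN'.ne', hN1, Nat.cast_one]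
      · obtain ⟨y, hy⟩ := hparent i hi x
        rw [one_mul, (hw i (x / N (i + 1)) y).2 (by rw [hN1]; simp)]
        exact hy
    · choose par hpar using hparent i hi
      have hq : ∀ x (j : ℤ), ((par x : ℤ) : ZMod (N i)) = j → G.Adj (w (i + 1) x) (w i j) := by
        intro x j h
        rw [← (hw i (par x) j).2]
        · exact hpar x
        · rw [← dvd_neg, neg_sub]; exact (ZMod.intCast_eq_intCast_iff_dvd_sub _ _ _).1 h
      have hq' : ∀ x j, G.Adj (w (i + 1) x) (w i j) → ((par x : ℤ) : ZMod (N i)) = j := by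
        intro x j h
        rw [ZMod.intCast_eq_intCast_iff_dvd_sub, ← hw i]
        exact hunique i hi x _ _ h (hpar x)
      have hnc : Noncrossing (N i) (N (i + 1)) fun x => ((par x : ℤ) : ZMod (N i)) := by
        refine hpl.noncrossing (C (fin i)) (C (fin (i + 1))) (hL.disjoint _ _ fun h => ?_) _ hq
        have := congrArg Fin.val h
        rw [hfin _ hi, hfin i (by omega)] at this
        omega
      obtain ⟨ε, hε, P, hP1, hP2, hP3, hP4⟩ := hnc.exists_lift h3 (hNpos (i + 1))
        (fun x => (hq' _ _ (by
          rw [(hw (i + 1) x (x + N (i + 1))).2 (by simp)]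
          exact hpar _)).symm)
        (fun j => by
          obtain ⟨j, rfl⟩ := ZMod.intCast_surjective j
          obtain ⟨x, hx⟩ := hchild i hi j
          exact ⟨x, hq' x j hx⟩)
      exact ⟨ε, hε, P, hP1, hP2, hP3, fun _ x => hq _ _ (hP4 x).symm⟩
  choose ε hε P hP1 hP2 hP3 hP4 using hlift
  -- Orient the layers consistently, one after the other.
  let σ : ℕ → ℤ := fun i => Nat.rec 1 (fun i s => s * ε i) i
  have hσs : ∀ i, σ (i + 1) = σ i * ε i := fun i => rfl
  have hσ : ∀ i, σ i = 1 ∨ σ i = -1 := by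
    intro i
    induction i with
    | zero => exact Or.inl rfl
    | succ i ih => rw [hσs]; rcases ih with h | h <;> rcases hε i with h' | h' <;> simp [h, h']
  have hσσ : ∀ i, σ i * σ i = 1 := fun i => by rcases hσ i with h | h <;> simp [h]
  have hdvd : ∀ i x y, (N i : ℤ) ∣ σ i * x - σ i * y ↔ (N i : ℤ) ∣ x - y := fun i x y => by
    rcases hσ i with h | h
    · simp [h]
    · rw [h, ← mul_sub, neg_one_mul, dvd_neg]
  have hadj : ∀ i, i + 1 < Δ → ∀ x,
      G.Adj (w (i + 1) (σ (i + 1) * x)) (w i (σ i * (σ i * P i (σ i * x)))) := by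
    intro i hi x
    rw [← mul_assoc, hσσ, one_mul, hσs, mul_comm (σ i), mul_assoc]
    exact hP4 i hi _
  refine ⟨Δ, N, fun i x => w i (σ i * x), fun i x => σ i * P i (σ i * x), hΔ, ?_, hNpos, ?_, ?_,
    ?_, ?_, ?_, ?_, hadj, ?_⟩
  · have h0 := hL.base (fin 0) (hfin 0 hΔ)
    have hle : n (fin 0) ≤ 1 := by
      rcases hn (fin 0) with h | h
      · exact h.le
      · by_contra _
        have a1 : (C (fin 0) ⟨0, by omega⟩ : V) ∈ ({v} : Set V) := by rw [← h0]; exact ⟨_, rfl⟩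
        have a2 : (C (fin 0) ⟨1, by omega⟩ : V) ∈ ({v} : Set V) := by rw [← h0]; exact ⟨_, rfl⟩
        have := (C (fin 0)).injective ((Set.mem_singleton_iff.1 a1).trans a2.symm)
        simp at this
    have := hNpos 0
    exact le_antisymm hle this
  · intro i x y hxy
    rcases hσ i with h | h
    · simpa [h] using hP1 i hxy
    · simpa [h] using hP1 i (neg_le_neg hxy)
  · intro i y
    obtain ⟨x, hx⟩ := hP2 i (σ i * y)
    exact ⟨σ i * x, by beta_reduce; rw [← mul_assoc, hσσ, one_mul, hx, ← mul_assoc, hσσ, one_mul]⟩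
  · intro i x
    rcases hσ i with h | h
    · simpa [h] using hP3 i x
    · have := hP3 i (-x - N (i + 1))
      rw [sub_add_cancel] at this
      simp only [h, neg_mul, one_mul, neg_add']
      omega
  · intro i hi j hj x y
    constructor
    · intro h
      have hij := hlayer i hi j hj _ _ h
      subst hij
      exact ⟨rfl, (hdvd _ _ _).1 ((hw _ _ _).1 h)⟩
    · rintro ⟨rfl, h⟩
      exact (hw _ _ _).2 ((hdvd _ _ _).2 h)
  · intro y
    obtain ⟨i, hi, x, rfl⟩ := hcover y
    exact ⟨i, hi, σ i * x, by rw [← mul_assoc, hσσ, one_mul]⟩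
  · intro i _ x
    rcases hσ i with h | h
    · simp only [h, one_mul]; exact cycleVertex_succ _ _
    · have := cycleVertex_succ (C (fin i)) (-(x + 1))
      simp only [h, neg_mul, one_mul]
      rw [show -(x + 1) + 1 = -x by ring] at this
      rcases this with h | h
      · exact Or.inl h.symm
      · exact Or.inr h.symm
  · intro y z hyz
    have hrep : ∀ y, ∃ i < Δ, ∃ x, w i (σ i * x) = y := by
      intro y
      obtain ⟨i, hi, x, rfl⟩ := hcover y
      exact ⟨i, hi, σ i * x, by rw [← mul_assoc, hσσ, one_mul]⟩
    obtain ⟨i, hi, x, rfl⟩ := hrep y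
    obtain ⟨j, hj, x', rfl⟩ := hrep z
    have hvert : ∀ i x x', i + 1 < Δ → G.Adj (w (i + 1) (σ (i + 1) * x)) (w i (σ i * x')) →
        w i (σ i * x') = w i (σ i * (σ i * P i (σ i * x))) := fun i x x' hi h =>
      hunique i hi _ _ _ h (hadj i hi x)
    rcases lt_trichotomy i j with h | h | h
    · rcases eq_or_lt_of_le (Nat.succ_le_of_lt h) with h' | h'
      · subst h'
        exact Or.inr ⟨i, hj, x', Or.inr ⟨rfl, hvert i x' x hj hyz.symm⟩⟩
      · exact absurd hyz (hsep _ _ _ _ hi hj h')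
    · subst h
      refine Or.inl ⟨i, hi, ?_⟩
      have key : (N i : ℤ) ∣ x - (x' + 1) ∨ (N i : ℤ) ∣ x' - (x + 1) := by
        have := dvd_of_cycleVertex_adj _ hyz
        rcases hσ i with h | h
        · simpa [h] using this
        · rw [h] at this
          rcases this with h | h
          · right; convert h using 1; ring
          · left; convert h using 1; ring
      rcases key with h | h
      · exact ⟨x', Or.inr ⟨rfl, (hw _ _ _).2 ((hdvd _ _ _).2 h)⟩⟩
      · exact ⟨x, Or.inl ⟨rfl, (hw _ _ _).2 ((hdvd _ _ _).2 h)⟩⟩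
    · rcases eq_or_lt_of_le (Nat.succ_le_of_lt h) with h' | h'
      · subst h'
        exact Or.inr ⟨j, hi, x, Or.inl ⟨rfl, hvert j x x' hi hyz⟩⟩
      · exact absurd hyz.symm (hsep _ _ _ _ hj hi h')

/-! ### Layered graphs with path layers -/

/-- The vertices of a layered graph with `Δ` layers: the pair `(k, j)` is the `j`-th vertex of the
`k`-th layer, which has `m k` vertices. -/
abbrev LayeredVertex (m : ℕ → ℕ) (Δ : ℕ) : Type := {z : ℕ × ℕ // z.1 < Δ ∧ z.2 < m z.1}

/-- `LayeredStep p x y`: either `y` follows `x` in its layer or `x` is the parent of `y`, where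
`p k j` is the position of the parent of `(k + 1, j)`. -/
def LayeredStep (p : ℕ → ℕ → ℕ) (x y : ℕ × ℕ) : Prop :=
  (y.1 = x.1 ∧ y.2 = x.2 + 1) ∨ (y.1 = x.1 + 1 ∧ x.2 = p x.1 y.2)

/-- The graph with `Δ` layers, the `k`-th of which is a path on `m k` vertices, and an edge from
each vertex `(k + 1, j)` to its parent `(k, p k j)`. -/
def layeredGraph (m : ℕ → ℕ) (p : ℕ → ℕ → ℕ) (Δ : ℕ) : SimpleGraph (LayeredVertex m Δ) where
  Adj x y := LayeredStep p x.1 y.1 ∨ LayeredStep p y.1 x.1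
  symm := ⟨fun _ _ h => h.symm⟩
  loopless := ⟨fun x h => by rcases h with (h | h) | (h | h) <;> omega⟩

/-- The layers are nonempty, the first one is a single vertex, and the parent maps are monotone. -/
structure IsLayerSeq (m : ℕ → ℕ) (p : ℕ → ℕ → ℕ) : Prop where
  zero : m 0 = 1
  pos : ∀ k, 0 < m k
  lt : ∀ k, ∀ j < m (k + 1), p k j < m k
  mono : ∀ k, ∀ i j, i ≤ j → j < m (k + 1) → p k i ≤ p k j

/-- Every vertex of the `k`-th layer is a parent. -/
def LayerSurj (m : ℕ → ℕ) (p : ℕ → ℕ → ℕ) (k : ℕ) : Prop :=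
  ∀ t < m k, ∃ j < m (k + 1), p k j = t

/-- The position of a vertex in the straight-line drawing of a layered graph. -/
def gridPoint (z : ℕ × ℕ) : ℝ × ℝ := (z.2, z.1)

theorem gridPoint_injective : Function.Injective gridPoint := by
  rintro ⟨a, b⟩ ⟨c, d⟩ h
  simpa [gridPoint, and_comm] using h

theorem exists_of_mem_segment_gridPoint {x y : ℕ × ℕ} {q : ℝ × ℝ}
    (h : q ∈ segment ℝ (gridPoint x) (gridPoint y)) :
    ∃ s : ℝ, 0 ≤ s ∧ s ≤ 1 ∧ q.1 = x.2 + s * (y.2 - x.2) ∧ q.2 = x.1 + s * (y.1 - x.1) := by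
  rw [segment_eq_image'] at h
  obtain ⟨s, ⟨h0, h1⟩, rfl⟩ := h
  exact ⟨s, h0, h1, by simp [gridPoint], by simp [gridPoint]⟩

theorem natCast_eq_add_unit {a b : ℕ} {s : ℝ} (h0 : 0 ≤ s) (h1 : s ≤ 1) (h : (a : ℝ) = b + s) :
    (a = b ∧ s = 0) ∨ (a = b + 1 ∧ s = 1) := by
  have hb : b ≤ a := by have : (b : ℝ) ≤ a := by linarith
                        exact_mod_cast this
  have ha : a ≤ b + 1 := by have : (a : ℝ) ≤ (b + 1 : ℕ) := by push_cast; linarith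
                            exact_mod_cast this
  rcases Nat.lt_or_ge b a with hlt | hge
  · obtain rfl : a = b + 1 := by omega
    right; refine ⟨rfl, ?_⟩; push_cast at h; linarith
  · obtain rfl : a = b := by omega
    left; exact ⟨rfl, by linarith⟩

theorem natCast_add_unit_eq {a b : ℕ} {s t : ℝ} (h0 : 0 ≤ s) (h1 : s ≤ 1) (h0' : 0 ≤ t)
    (h1' : t ≤ 1) (h : (a : ℝ) + s = b + t) :
    a = b ∨ (b = a + 1 ∧ s = 1 ∧ t = 0) ∨ (a = b + 1 ∧ s = 0 ∧ t = 1) := by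
  rcases lt_trichotomy a b with hlt | heq | hlt
  · have : ((a + 1 : ℕ) : ℝ) ≤ b := by exact_mod_cast hlt
    push_cast at this
    have ht : t = 0 := by linarith
    have hs : s = 1 := by linarith
    subst ht; subst hs
    refine Or.inr (Or.inl ⟨?_, rfl, rfl⟩)
    have : ((a + 1 : ℕ) : ℝ) = b := by push_cast; linarith
    exact_mod_cast this.symm
  · exact Or.inl heq
  · have : ((b + 1 : ℕ) : ℝ) ≤ a := by exact_mod_cast hlt
    push_cast at this
    have ht : s = 0 := by linarith
    have hs : t = 1 := by linarith
    subst ht; subst hs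
    refine Or.inr (Or.inr ⟨?_, rfl, rfl⟩)
    have : ((b + 1 : ℕ) : ℝ) = a := by push_cast; linarith
    exact_mod_cast this.symm

theorem gridPoint_mem_segment {p : ℕ → ℕ → ℕ} {x y w : ℕ × ℕ} (hxy : LayeredStep p x y)
    (hw : gridPoint w ∈ segment ℝ (gridPoint x) (gridPoint y)) : w = x ∨ w = y := by
  obtain ⟨s, h0, h1, e1, e2⟩ := exists_of_mem_segment_gridPoint hw
  obtain ⟨k, j⟩ := x
  obtain ⟨k', j'⟩ := y
  obtain ⟨l, i⟩ := w
  simp only [gridPoint] at e1 e2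
  rcases hxy with ⟨h, h'⟩ | ⟨h, -⟩
  · simp only at h h'
    subst h h'
    push_cast at e1
    have e2' : l = k' := by have : (l : ℝ) = k' := by linarith
                            exact_mod_cast this
    subst e2'
    rcases natCast_eq_add_unit h0 h1 (by linarith : (i : ℝ) = j + s) with ⟨h, -⟩ | ⟨h, -⟩
    · left; rw [h]
    · right; rw [h]
  · simp only at h
    subst h
    push_cast at e2
    rcases natCast_eq_add_unit h0 h1 (by linarith : (l : ℝ) = k + s) with ⟨h, hs⟩ | ⟨h, hs⟩
    · left; subst hs
      have : (i : ℝ) = j := by linarith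
      rw [h, Nat.cast_injective this]
    · right; subst hs
      have : (i : ℝ) = j' := by linarith
      rw [h, Nat.cast_injective this]

/-- Two edges of the straight-line drawing meet only in a common endpoint. -/
theorem segment_gridPoint_inter {p : ℕ → ℕ → ℕ} {x y x' y' : ℕ × ℕ} (hxy : LayeredStep p x y)
    (hxy' : LayeredStep p x' y')
    (h1 : x.1 = x'.1 → y.1 = x.1 + 1 → y'.1 = x.1 + 1 → y.2 ≤ y'.2 → p x.1 y.2 ≤ p x.1 y'.2)
    (h2 : x.1 = x'.1 → y.1 = x.1 + 1 → y'.1 = x.1 + 1 → y'.2 ≤ y.2 → p x.1 y'.2 ≤ p x.1 y.2)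
    {q : ℝ × ℝ}
    (hq : q ∈ segment ℝ (gridPoint x) (gridPoint y))
    (hq' : q ∈ segment ℝ (gridPoint x') (gridPoint y')) :
    (x = x' ∧ y = y') ∨ ∃ w, (w = x ∨ w = y) ∧ (w = x' ∨ w = y') ∧ q = gridPoint w := by
  -- A point of an edge inside a layer that lies on another edge.
  have key : ∀ {x y x' y' : ℕ × ℕ}, (y.1 = x.1 ∧ y.2 = x.2 + 1) → LayeredStep p x' y' →
      q ∈ segment ℝ (gridPoint x) (gridPoint y) → q ∈ segment ℝ (gridPoint x') (gridPoint y') →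
      (x = x' ∧ y = y') ∨ ∃ w, (w = x ∨ w = y) ∧ (w = x' ∨ w = y') ∧ q = gridPoint w := by
    rintro ⟨k, j⟩ ⟨l, i⟩ ⟨k', j'⟩ ⟨l', i'⟩ ⟨h, h'⟩ hst hq hq'
    simp only at h h'
    subst h h'
    obtain ⟨s, h0, h1, e1, e2⟩ := exists_of_mem_segment_gridPoint hq
    obtain ⟨t, h0', h1', e1', e2'⟩ := exists_of_mem_segment_gridPoint hq'
    push_cast at e1 e2 e1' e2'
    rcases hst with ⟨g, g'⟩ | ⟨g, -⟩
    · simp only at g g'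
      subst g g'
      push_cast at e1'
      have hl : l = l' := by have : (l : ℝ) = l' := by linarith
                             exact_mod_cast this
      subst hl
      rcases natCast_add_unit_eq h0 h1 h0' h1' (by linarith : (j : ℝ) + s = j' + t) with
        h | ⟨h, hs, ht⟩ | ⟨h, hs, ht⟩
      · subst h; exact Or.inl ⟨rfl, rfl⟩
      · subst h hs ht
        refine Or.inr ⟨(l, j + 1), Or.inr rfl, Or.inl rfl, Prod.ext ?_ ?_⟩
        · simp only [gridPoint]; push_cast; linarith
        · simp only [gridPoint]; linarith
      · subst h hs ht
        refine Or.inr ⟨(l, j' + 1), Or.inl rfl, Or.inr rfl, Prod.ext ?_ ?_⟩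
        · simp only [gridPoint]; push_cast; push_cast at e1; linarith
        · simp only [gridPoint]; linarith
    · have hend : ∃ w : ℕ × ℕ, (w = (k', j') ∨ w = (l', i')) ∧ q = gridPoint w := by
        simp only at g
        subst g
        push_cast at e2'
        rcases natCast_eq_add_unit h0' h1' (by linarith : (l : ℝ) = k' + t) with
          ⟨h, ht⟩ | ⟨h, ht⟩
        · subst ht
          refine ⟨_, Or.inl rfl, Prod.ext ?_ ?_⟩ <;> simp only [gridPoint] <;> linarith
        · subst ht
          refine ⟨_, Or.inr rfl, Prod.ext ?_ ?_⟩
          · simp only [gridPoint]; linarith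
          · simp only [gridPoint]; push_cast; linarith
      obtain ⟨w, hw, rfl⟩ := hend
      exact Or.inr ⟨w, gridPoint_mem_segment (p := p) (Or.inl ⟨rfl, rfl⟩) hq, hw, rfl⟩
  have hxy0 := hxy
  rcases hxy with h | ⟨h, g⟩
  · exact key h hxy' hq hq'
  rcases hxy' with h' | ⟨h', g'⟩
  · rcases key h' hxy0 hq' hq with ⟨ha, hb⟩ | ⟨w, hw, hw', hqw⟩
    · exact Or.inl ⟨ha.symm, hb.symm⟩
    · exact Or.inr ⟨w, hw', hw, hqw⟩
  obtain ⟨s, h0, hs1, e1, e2⟩ := exists_of_mem_segment_gridPoint hq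
  obtain ⟨t, h0', ht1, e1', e2'⟩ := exists_of_mem_segment_gridPoint hq'
  obtain ⟨k, j⟩ := x
  obtain ⟨l, i⟩ := y
  obtain ⟨k', j'⟩ := x'
  obtain ⟨l', i'⟩ := y'
  simp only at h h' g g' h1 h2 e1 e2 e1' e2'
  subst h h'
  push_cast at e2 e2'
  rcases natCast_add_unit_eq h0 hs1 h0' ht1 (by linarith : (k : ℝ) + s = k' + t) with
    hk | ⟨hk, hs, ht⟩ | ⟨hk, hs, ht⟩
  · subst hk
    obtain rfl : s = t := by linarith
    rcases lt_trichotomy i i' with hi | hi | hi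
    · have hp := h1 rfl rfl rfl hi.le
      rw [← g, ← g'] at hp
      have a1 : (j : ℝ) ≤ j' := by exact_mod_cast hp
      have a2 : (i : ℝ) < i' := by exact_mod_cast hi
      have hs : s = 0 := by
        by_contra hne
        have : 0 < s := lt_of_le_of_ne h0 (Ne.symm hne)
        nlinarith [mul_nonneg (sub_nonneg.2 hs1) (sub_nonneg.2 a1), mul_pos this (sub_pos.2 a2)]
      subst hs
      have : j = j' := by have : (j : ℝ) = j' := by linarith
                          exact_mod_cast this
      subst this
      refine Or.inr ⟨_, Or.inl rfl, Or.inl rfl, Prod.ext ?_ ?_⟩ <;> simp only [gridPoint] <;>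
        linarith
    · subst hi; rw [g, g']; exact Or.inl ⟨rfl, rfl⟩
    · have hp := h2 rfl rfl rfl hi.le
      rw [← g, ← g'] at hp
      have a1 : (j' : ℝ) ≤ j := by exact_mod_cast hp
      have a2 : (i' : ℝ) < i := by exact_mod_cast hi
      have hs : s = 0 := by
        by_contra hne
        have : 0 < s := lt_of_le_of_ne h0 (Ne.symm hne)
        nlinarith [mul_nonneg (sub_nonneg.2 hs1) (sub_nonneg.2 a1), mul_pos this (sub_pos.2 a2)]
      subst hs
      have : j = j' := by have : (j : ℝ) = j' := by linarith
                          exact_mod_cast this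
      subst this
      refine Or.inr ⟨_, Or.inl rfl, Or.inl rfl, Prod.ext ?_ ?_⟩ <;> simp only [gridPoint] <;>
        linarith
  · subst hk hs ht
    have : i = j' := by have : (i : ℝ) = j' := by linarith
                        exact_mod_cast this
    subst this
    refine Or.inr ⟨_, Or.inr rfl, Or.inl rfl, Prod.ext ?_ ?_⟩
    · simp only [gridPoint]; linarith
    · simp only [gridPoint]; push_cast; linarith
  · subst hk hs ht
    have : i' = j := by have : (i' : ℝ) = j := by linarith
                        exact_mod_cast this
    subst this
    refine Or.inr ⟨_, Or.inl rfl, Or.inr rfl, Prod.ext ?_ ?_⟩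
    · simp only [gridPoint]; linarith
    · simp only [gridPoint]; push_cast; linarith

theorem layeredGraph_isPlanar {m : ℕ → ℕ} {p : ℕ → ℕ → ℕ} (h : IsLayerSeq m p) (Δ : ℕ) :
    IsPlanar (layeredGraph m p Δ) := by
  let arc : Sym2 (LayeredVertex m Δ) → Set (ℝ × ℝ) :=
    Sym2.lift ⟨fun x y => segment ℝ (gridPoint x.1) (gridPoint y.1), fun x y => segment_symm ..⟩
  have harc : ∀ x y, arc s(x, y) = segment ℝ (gridPoint x.1) (gridPoint y.1) := fun x y => rfl
  have hinj : Function.Injective fun x : LayeredVertex m Δ => gridPoint x.1 :=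
    gridPoint_injective.comp Subtype.val_injective
  have hedge : ∀ e ∈ (layeredGraph m p Δ).edgeSet, ∃ x y : LayeredVertex m Δ,
      LayeredStep p x.1 y.1 ∧ e = s(x, y) := by
    intro e he
    induction e with | _ x y =>
    rcases he with h | h
    · exact ⟨x, y, h, rfl⟩
    · exact ⟨y, x, h, Sym2.eq_swap⟩
  refine ⟨fun x => gridPoint x.1, arc, hinj, fun x y hxy => ?_, fun e he w hw => ?_,
    fun e he e' he' hne q hq => ?_⟩
  · refine ⟨Path.segment _ _, Path.segment_injective_of_ne ?_, Path.range_segment _ _⟩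
    exact fun h => hxy.ne (hinj h)
  · obtain ⟨x, y, hxy, rfl⟩ := hedge e he
    rw [harc] at hw
    rw [Sym2.mem_iff]
    rcases gridPoint_mem_segment hxy hw with h | h
    · exact Or.inl (Subtype.ext h)
    · exact Or.inr (Subtype.ext h)
  · obtain ⟨x, y, hxy, rfl⟩ := hedge e he
    obtain ⟨x', y', hxy', rfl⟩ := hedge e' he'
    rw [harc, harc] at hq
    have hm : ∀ {x y y' : LayeredVertex m Δ}, (y.1.1 = x.1.1 + 1) → (y'.1.1 = x.1.1 + 1) →
        y.1.2 ≤ y'.1.2 → p x.1.1 y.1.2 ≤ p x.1.1 y'.1.2 := by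
      intro x y y' h1 h2 h3
      exact h.mono _ _ _ h3 (h2 ▸ y'.2.2)
    rcases segment_gridPoint_inter hxy hxy' (fun _ => hm) (fun _ h1 h2 => hm h2 h1) hq.1 hq.2 with
      ⟨ha, hb⟩ | ⟨w, hw, hw', hqw⟩
    · exact absurd (by rw [Subtype.ext ha, Subtype.ext hb]) hne
    · rcases hw with rfl | rfl
      · exact ⟨x, Sym2.mem_mk_left _ _, Sym2.mem_iff.2 (hw'.imp Subtype.ext Subtype.ext), hqw⟩
      · exact ⟨y, Sym2.mem_mk_right _ _, Sym2.mem_iff.2 (hw'.imp Subtype.ext Subtype.ext), hqw⟩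

/-! ### Pyramids and their 1-sums -/

section Pyramid

variable {m : ℕ → ℕ} {p : ℕ → ℕ → ℕ} {Δ : ℕ}

theorem layeredGraph_adj_succ (k j : ℕ) (hk : k < Δ) (hj : j + 1 < m k) :
    (layeredGraph m p Δ).Adj ⟨(k, j), hk, by simp only; omega⟩ ⟨(k, j + 1), hk, hj⟩ :=
  Or.inl (Or.inl ⟨rfl, rfl⟩)

theorem layeredGraph_adj_parent (h : IsLayerSeq m p) (k j : ℕ) (hk : k + 1 < Δ)
    (hj : j < m (k + 1)) : (layeredGraph m p Δ).Adj ⟨(k + 1, j), hk, hj⟩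
      ⟨(k, p k j), by simp only; omega, h.lt k j hj⟩ :=
  Or.inr (Or.inr ⟨rfl, rfl⟩)

/-- Consecutive layers induce a connected graph, since parents lead to the first of them. -/
theorem layeredGraph_induce_connected (h : IsLayerSeq m p) {a b : ℕ} (hab : a < b) (hb : b ≤ Δ) :
    ((layeredGraph m p Δ).induce {z | a ≤ z.1.1 ∧ z.1.1 < b}).Connected := by
  set S : Set (LayeredVertex m Δ) := {z | a ≤ z.1.1 ∧ z.1.1 < b}
  let base : S := ⟨⟨(a, 0), by simp only; omega, h.pos a⟩, le_rfl, hab⟩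
  have hrow : ∀ j (hj : j < m a), ((layeredGraph m p Δ).induce S).Reachable
      ⟨⟨(a, j), by simp only; omega, hj⟩, le_rfl, hab⟩ base := by
    intro j
    induction j with
    | zero => intro _; exact .refl _
    | succ j ih =>
      intro hj
      refine .trans (SimpleGraph.Adj.reachable ?_) (ih (by omega))
      exact (layeredGraph_adj_succ a j (by omega) hj).symm
  have hcol : ∀ d j (hd : a + d < b) (hj : j < m (a + d)), ((layeredGraph m p Δ).induce S).Reachable
      ⟨⟨(a + d, j), by simp only; omega, hj⟩, Nat.le_add_right a d, hd⟩ base := by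
    intro d
    induction d with
    | zero => intro j _ hj; exact hrow j hj
    | succ d ih =>
      intro j hd hj
      refine .trans (SimpleGraph.Adj.reachable ?_)
        (ih (p (a + d) j) (by omega) (h.lt (a + d) j hj))
      exact layeredGraph_adj_parent h (a + d) j (by omega) hj
  have hall : ∀ z : S, ((layeredGraph m p Δ).induce S).Reachable z base := by
    rintro ⟨⟨⟨k, j⟩, hk, hj⟩, hz1, hz2⟩
    obtain ⟨d, rfl⟩ : ∃ d, k = a + d := ⟨k - a, by simp only at hz1; omega⟩
    exact hcol d j hz2 hj
  have : Nonempty S := ⟨base⟩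
  exact ⟨fun x y => (hall x).trans (hall y).symm⟩

/-- The `k`-th layer of a layered graph as an embedded path. -/
def layerPath (m : ℕ → ℕ) (p : ℕ → ℕ → ℕ) (Δ : ℕ) (k : Fin Δ) :
    SimpleGraph.pathGraph (m k) ↪g layeredGraph m p Δ where
  toFun j := ⟨(k, j), k.2, j.2⟩
  inj' i j hij := by
    have := congrArg (fun z : LayeredVertex m Δ => z.1.2) hij
    exact Fin.ext this
  map_rel_iff' := by
    intro i j
    rw [SimpleGraph.pathGraph_adj]
    change (LayeredStep p (k.val, i.val) (k.val, j.val) ∨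
      LayeredStep p (k.val, j.val) (k.val, i.val)) ↔ _
    simp only [LayeredStep, true_and]
    omega

theorem layerPath_val (k : Fin Δ) (j : Fin (m k)) :
    (layerPath m p Δ k j).1 = (k.val, j.val) := rfl

theorem mem_range_layerPath (k : Fin Δ) (z : LayeredVertex m Δ) :
    z ∈ Set.range (layerPath m p Δ k) ↔ z.1.1 = k := by
  constructor
  · rintro ⟨j, rfl⟩; rfl
  · rcases z with ⟨⟨k', j⟩, hk, hj⟩
    intro h
    simp only at h
    subst h
    exact ⟨⟨j, hj⟩, rfl⟩

/-- A layered graph in which every vertex outside the last layer has a child is a pyramid. -/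
theorem layeredGraph_isPyramid (h : IsLayerSeq m p) (hΔ : 0 < Δ)
    (hs : ∀ k, k + 1 < Δ → LayerSurj m p k) : IsPyramid (layeredGraph m p Δ) := by
  refine ⟨layeredGraph_isPlanar h Δ, ⟨(0, 0), hΔ, h.pos 0⟩, Δ, fun k => m k, layerPath m p Δ, hΔ,
    fun k => h.pos k, ⟨?_, ?_, ?_, ?_, ?_, ?_⟩, ?_⟩
  · intro i j hij
    rw [Set.disjoint_left]
    intro z hi hj
    rw [mem_range_layerPath] at hi hj
    exact hij (Fin.ext (hi.symm.trans hj))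
  · ext z
    simp only [Set.mem_iUnion, mem_range_layerPath, Set.mem_univ, iff_true]
    exact ⟨⟨z.1.1, z.2.1⟩, rfl⟩
  · intro i hi
    ext z
    rw [mem_range_layerPath, hi, Set.mem_singleton_iff]
    rcases z with ⟨⟨k, j⟩, hk, hj⟩
    constructor
    · intro hz
      simp only at hz hj
      subst hz
      rw [h.zero] at hj
      exact Subtype.ext (Prod.ext rfl (by simp only; omega))
    · intro hz; rw [hz]
  · intro i hi hi'
    refine ⟨?_, ?_, ?_⟩
    · have : (⋃ j, ⋃ _ : j < i, Set.range (layerPath m p Δ j)) =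
          {z : LayeredVertex m Δ | 0 ≤ z.1.1 ∧ z.1.1 < i.val} := by
        ext z
        simp only [Set.mem_iUnion, mem_range_layerPath, Set.mem_ofPred_eq, Nat.zero_le, true_and]
        constructor
        · rintro ⟨j, hj, hz⟩; rw [hz]; exact hj
        · intro hz; exact ⟨⟨z.1.1, z.2.1⟩, hz, rfl⟩
      rw [this]
      exact layeredGraph_induce_connected h hi i.2.le
    · have : (⋃ j, ⋃ _ : i < j, Set.range (layerPath m p Δ j)) =
          {z : LayeredVertex m Δ | i.val + 1 ≤ z.1.1 ∧ z.1.1 < Δ} := by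
        ext z
        simp only [Set.mem_iUnion, mem_range_layerPath, Set.mem_ofPred_eq]
        constructor
        · rintro ⟨j, hj, hz⟩; rw [hz]; exact ⟨hj, j.2⟩
        · intro hz; exact ⟨⟨z.1.1, z.2.1⟩, hz.1, rfl⟩
      rw [this]
      exact layeredGraph_induce_connected h hi' le_rfl
    · intro j k hj hk x hx y hy hxy
      rw [mem_range_layerPath] at hx hy
      rw [Fin.lt_def] at hj hk
      rcases hxy with (h | h) | (h | h) <;> omega
  · intro i j hij x hx
    rw [mem_range_layerPath] at hx
    rcases x with ⟨⟨k, t⟩, hk, ht⟩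
    simp only at hx ht hk
    rw [hij] at hx
    subst hx
    refine ⟨⟨(i, p i t), i.2, h.lt i t ht⟩, ⟨(mem_range_layerPath _ _).2 rfl,
      layeredGraph_adj_parent h i t hk ht⟩, ?_⟩
    rintro ⟨⟨k', t'⟩, hk', ht'⟩ ⟨hy, hadj⟩
    rw [mem_range_layerPath] at hy
    simp only at hy
    subst hy
    rcases hadj with (⟨h1, h2⟩ | ⟨h1, h2⟩) | (⟨h1, h2⟩ | ⟨h1, h2⟩) <;> simp only at h1 h2
    · omega
    · omega
    · omega
    · exact Subtype.ext (Prod.ext rfl h2)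
  · intro i j hij y hy
    rw [mem_range_layerPath] at hy
    rcases y with ⟨⟨k, t⟩, hk, ht⟩
    simp only at hy ht hk
    subst hy
    have hj : i.val + 1 < Δ := hij ▸ j.2
    obtain ⟨s, hs1, rfl⟩ := hs i hj t ht
    exact ⟨⟨(i + 1, s), hj, hs1⟩, (mem_range_layerPath _ _).2 hij.symm,
      (layeredGraph_adj_parent h i s hj hs1).symm⟩
  · intro i i' hii' j t j' t' h1 h2 hjt
    have key : ∀ (j : Fin (m i)) (j' : Fin (m i')),
        (layeredGraph m p Δ).Adj (layerPath m p Δ i j) (layerPath m p Δ i' j') →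
          j.val = p i j' := by
      intro j j' hadj
      rcases hadj with (⟨h1, h2⟩ | ⟨h1, h2⟩) | (⟨h1, h2⟩ | ⟨h1, h2⟩) <;>
        simp only [layerPath_val] at h1 h2 <;> omega
    rw [Fin.le_def, key j j' h1, key t t' h2]
    exact h.mono i j' t' hjt (hii' ▸ t'.2)

/-- A layered graph in which every layer with a childless vertex is followed by a layer consisting
of a single vertex is a repeated 1-sum of pyramids: it is split at the parent of each such single
vertex. -/
theorem layeredGraph_mem_oneSumClosure (h : IsLayerSeq m p) (hΔ : 0 < Δ)
    (hs : ∀ k, k + 1 < Δ → LayerSurj m p k ∨ m (k + 1) = 1) :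
    OneSumClosure (fun _ H => IsPyramid H) (LayeredVertex m Δ) (layeredGraph m p Δ) := by
  classical
  induction Δ using Nat.strong_induction_on with | _ Δ ih =>
  by_cases hall : ∀ k, k + 1 < Δ → LayerSurj m p k
  · exact .base (layeredGraph_isPyramid h hΔ hall)
  -- The last layer with a childless vertex.
  have hex : ∃ k, k + 1 < Δ ∧ ¬ LayerSurj m p k := by push Not at hall; exact hall
  obtain ⟨k, ⟨hkΔ, hk⟩, hmax⟩ : ∃ k, (k + 1 < Δ ∧ ¬ LayerSurj m p k) ∧
      ∀ l, (l + 1 < Δ ∧ ¬ LayerSurj m p l) → l ≤ k := by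
    obtain ⟨k₀, hk₀⟩ := hex
    refine ⟨Nat.findGreatest (fun k => k + 1 < Δ ∧ ¬ LayerSurj m p k) Δ,
      Nat.findGreatest_spec (P := fun k => k + 1 < Δ ∧ ¬ LayerSurj m p k) (m := k₀) (by omega) hk₀,
      fun l hl => Nat.le_findGreatest (by omega) hl⟩
  have hm1 : m (k + 1) = 1 := (hs k hkΔ).resolve_left hk
  have hup := ih (k + 1) hkΔ (by omega) fun l hl => hs l (by omega)
  -- The part below this layer, with the parent of its single top vertex as the new basepoint.
  let m' : ℕ → ℕ := fun j => if j = 0 then 1 else m (k + j)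
  let p' : ℕ → ℕ → ℕ := fun j t => if j = 0 then 0 else p (k + j) t
  have h' : IsLayerSeq m' p' := by
    refine ⟨rfl, fun j => ?_, fun j t ht => ?_, fun j s t hst ht => ?_⟩
    · by_cases hj : j = 0
      · simp [m', hj]
      · simp [m', hj, h.pos]
    · by_cases hj : j = 0
      · simp [m', p', hj]
      · simp only [m', p', hj, if_false] at ht ⊢
        exact h.lt _ _ ht
    · by_cases hj : j = 0
      · simp [p', hj]
      · simp only [m', p', hj, if_false] at ht ⊢
        exact h.mono _ _ _ hst ht
  have hlow : IsPyramid (layeredGraph m' p' (Δ - k)) := by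
    refine layeredGraph_isPyramid h' (by omega) fun j hj t ht => ?_
    by_cases hj0 : j = 0
    · subst hj0
      simp only [m', if_true] at ht
      refine ⟨0, h'.pos _, ?_⟩
      simp only [p', if_true]; omega
    · simp only [m', p', hj0, if_false] at ht ⊢
      have : LayerSurj m p (k + j) := by
        by_contra hcon
        have := hmax (k + j) ⟨by omega, hcon⟩
        omega
      exact this t ht
  obtain ⟨f, hfv⟩ : ∃ f : LayeredVertex m (k + 1) ↪ LayeredVertex m Δ, ∀ z, (f z).1 = z.1 :=
    ⟨⟨fun z => ⟨z.1, by have := z.2.1; omega, z.2.2⟩, fun x y hxy => Subtype.ext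
      (congrArg (fun z : LayeredVertex m Δ => z.1) hxy)⟩, fun z => rfl⟩
  have hz0 : p k 0 < m k := h.lt k 0 (h.pos _)
  let g₀ : ℕ × ℕ → ℕ × ℕ := fun z => if z.1 = 0 then (k, p k 0) else (k + z.1, z.2)
  have g0 : ∀ t, g₀ (0, t) = (k, p k 0) := fun t => rfl
  have gs : ∀ j t, g₀ (j + 1, t) = (k + j + 1, t) := fun j t => rfl
  have m0 : m' 0 = 1 := rfl
  have ms : ∀ j, m' (j + 1) = m (k + j + 1) := fun j => rfl
  have p0 : ∀ t, p' 0 t = 0 := fun t => rfl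
  have ps : ∀ j t, p' (j + 1) t = p (k + j + 1) t := fun j t => rfl
  obtain ⟨g, hgv⟩ : ∃ g : LayeredVertex m' (Δ - k) ↪ LayeredVertex m Δ, ∀ z, (g z).1 = g₀ z.1 := by
    refine ⟨⟨fun z => ⟨g₀ z.1, ?_⟩, ?_⟩, fun z => rfl⟩
    · obtain ⟨⟨j, t⟩, hj, ht⟩ := z
      rcases j with _ | j
      · exact ⟨by rw [g0]; simp only; omega, hz0⟩
      · exact ⟨by rw [gs]; simp only at hj ⊢; omega, ht⟩
    · rintro ⟨⟨j, t⟩, hj, ht⟩ ⟨⟨j', t'⟩, hj', ht'⟩ hxy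
      have hxy' : g₀ (j, t) = g₀ (j', t') := congrArg (fun z : LayeredVertex m Δ => z.1) hxy
      refine Subtype.ext ?_
      change (j, t) = (j', t')
      have h1 : t < m' j := ht
      have h2 : t' < m' j' := ht'
      rcases j with _ | j <;> rcases j' with _ | j' <;>
        simp only [g0, gs, m0, Prod.mk.injEq, true_and] at hxy' h1 h2 ⊢ <;> omega
  clear_value g₀ m' p'
  have hf : ∀ z : LayeredVertex m Δ, z ∈ Set.range f ↔ z.1.1 ≤ k := by
    intro z
    constructor
    · rintro ⟨y, rfl⟩; rw [hfv]; have := y.2.1; omega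
    · intro hz; exact ⟨⟨z.1, by omega, z.2.2⟩, Subtype.ext (hfv _)⟩
  have hg : ∀ z : LayeredVertex m Δ, z ∈ Set.range g ↔ k < z.1.1 ∨ z.1 = (k, p k 0) := by
    intro z
    constructor
    · rintro ⟨⟨⟨j, t⟩, hj, ht⟩, rfl⟩
      rw [hgv]
      rcases j with _ | j
      · exact Or.inr (g0 _)
      · left; rw [gs]; simp only; omega
    · rintro (hz | hz)
      · obtain ⟨⟨l, t⟩, hl, ht⟩ := z
        obtain ⟨j, rfl⟩ : ∃ j, l = k + j + 1 := ⟨l - k - 1, by simp only at hz; omega⟩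
        exact ⟨⟨(j + 1, t), by simp only at hl ⊢; omega, by simpa only [ms] using ht⟩,
          Subtype.ext (by rw [hgv, gs])⟩
      · exact ⟨⟨(0, 0), by simp only; omega, by simp only [m0]; omega⟩,
          Subtype.ext (by rw [hgv, g0, hz])⟩
  have hstep : ∀ x y : LayeredVertex m' (Δ - k), x.1.1 < y.1.1 ∨ 0 < x.1.1 →
      (LayeredStep p' x.1 y.1 ↔ LayeredStep p (g x).1 (g y).1) := by
    rintro ⟨⟨j, t⟩, hj, ht⟩ ⟨⟨j', t'⟩, hj', ht'⟩ hjj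
    rw [hgv, hgv]
    rcases j with _ | j <;> rcases j' with _ | j' <;>
      simp only [LayeredStep, g0, gs, m0, ms, p0, ps, true_and] at ht ht' hjj ⊢
    · omega
    · rcases j' with _ | j'
      · rw [add_zero, hm1] at ht'
        obtain rfl : t' = 0 := by omega
        obtain rfl : t = 0 := by omega
        simp
      · omega
    · omega
    · have : k + j' + 1 = k + j + 1 + 1 ↔ j' + 1 = j + 1 + 1 := by omega
      omega
  refine .sum hup (.base hlow) ⟨f, g, ⟨(k, p k 0), by simp only; omega, hz0⟩, ?_, ?_, ?_⟩
  · ext z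
    rw [Set.mem_inter_iff, hf, hg, Set.mem_singleton_iff]
    constructor
    · rintro ⟨h1, h2 | h2⟩
      · omega
      · exact Subtype.ext h2
    · rintro rfl; exact ⟨le_rfl, Or.inr rfl⟩
  · ext z
    rw [Set.mem_union, hf, hg]
    simp only [Set.mem_univ, iff_true]
    omega
  · refine le_antisymm ?_ (sup_le ?_ ?_)
    · have key : ∀ x y : LayeredVertex m Δ, LayeredStep p x.1 y.1 →
          ((layeredGraph m p (k + 1)).map f ⊔ (layeredGraph m' p' (Δ - k)).map g).Adj x y := by
        intro x y hxy
        rw [SimpleGraph.sup_adj]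
        have hle : x.1.1 ≤ y.1.1 := by rcases hxy with hxy | hxy <;> omega
        rcases Nat.lt_or_ge k y.1.1 with hy | hy
        · right
          obtain ⟨y', hy'⟩ := (hg y).2 (Or.inl hy)
          have hx : x ∈ Set.range g := by
            rw [hg]
            rcases Nat.lt_or_ge k x.1.1 with hx | hx
            · exact Or.inl hx
            · right
              rcases hxy with hxy | hxy
              · omega
              · have hxk : x.1.1 = k := by omega
                have hy0 : y.1.2 = 0 := by
                  have := y.2.2
                  rw [hxy.1, hxk, hm1] at this; omega
                have h2 := hxy.2
                rw [hxk, hy0] at h2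
                exact Prod.ext hxk h2
          obtain ⟨x', rfl⟩ := hx
          subst hy'
          rw [SimpleGraph.map_adj]
          refine ⟨x', y', Or.inl ((hstep x' y' ?_).2 hxy), rfl, rfl⟩
          rcases x' with ⟨⟨j, t⟩, hj, ht⟩
          rcases y' with ⟨⟨j', t'⟩, hj', ht'⟩
          rw [hgv] at hy
          rcases j' with _ | j'
          · rw [g0] at hy; simp only at hy; omega
          · simp only; omega
        · left
          obtain ⟨x', rfl⟩ := (hf x).2 (by omega)
          obtain ⟨y', rfl⟩ := (hf y).2 hy
          rw [hfv, hfv] at hxy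
          rw [SimpleGraph.map_adj]
          exact ⟨x', y', Or.inl hxy, rfl, rfl⟩
      intro x y hxy
      rcases hxy with hxy | hxy
      · exact key x y hxy
      · exact (key y x hxy).symm
    · intro x y hxy
      rw [SimpleGraph.map_adj] at hxy
      obtain ⟨x', y', hadj, rfl, rfl⟩ := hxy
      simp only [layeredGraph, hfv]
      exact hadj
    · have key : ∀ x y : LayeredVertex m' (Δ - k), LayeredStep p' x.1 y.1 →
          LayeredStep p (g x).1 (g y).1 := by
        intro x y hxy
        refine (hstep x y ?_).1 hxy
        have h1 := x.2.2
        have h2 := y.2.2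
        rcases hxy with ⟨ha, hb⟩ | hxy
        · right
          by_contra h0
          rw [ha, show x.1.1 = 0 by omega, m0] at h2
          omega
        · omega
      intro x y hxy
      rw [SimpleGraph.map_adj] at hxy
      obtain ⟨x', y', hadj, rfl, rfl⟩ := hxy
      exact hadj.imp (key _ _) (key _ _)

end Pyramid

/-! ### Cutting a funnel into strips -/

section Strips

variable (n g : ℕ → ℕ) (P : ℕ → ℤ → ℤ) (a : ℕ → ℤ)

/-- The levels of the graph that a funnel is cut into. The level in state `(i, 0)` is the `i`-th
layer of the funnel; if `g i ≠ 0`, it is preceded by `g i` auxiliary levels, in the states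
`(i, h)` with `h = g i, …, 1`. -/
def levelState : ℕ → ℕ × ℕ
  | 0 => (0, 0)
  | k + 1 => if (levelState k).2 = 0 then ((levelState k).1 + 1, g ((levelState k).1 + 1))
      else ((levelState k).1, (levelState k).2 - 1)

/-- The level that carries the `i`-th layer of the funnel. -/
def layerIndex : ℕ → ℕ
  | 0 => 0
  | i + 1 => layerIndex i + 1 + g (i + 1)

/-- The number of vertices of a level: the auxiliary level in state `(i, g i)` is a single vertex,
the apex, and all levels below it down to the `i`-th layer are copies of that layer. -/
def stripWidth (k : ℕ) : ℕ :=
  if (levelState g k).2 = 0 ∨ (levelState g k).2 < g (levelState g k).1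
    then n (levelState g k).1 else 1

/-- The parent maps: between consecutive layers without auxiliary levels the cyclic parent map, read
from the cut positions `a i` and `a (i + 1)` on; between copies of a layer the identity; and `0`
next to an apex. -/
def stripParent (k j : ℕ) : ℕ :=
  if (levelState g k).2 = 0 then
    if g ((levelState g k).1 + 1) = 0 then
      (P (levelState g k).1 (a ((levelState g k).1 + 1) + j) - a (levelState g k).1).toNat
    else 0
  else if (levelState g k).2 < g (levelState g k).1 then j else 0

variable {n g P a}

theorem levelState_layerIndex (i : ℕ) : levelState g (layerIndex g i) = (i, 0) := by
  induction i with
  | zero => rfl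
  | succ i ih =>
    have key : ∀ j ≤ g (i + 1),
        levelState g (layerIndex g i + 1 + j) = (i + 1, g (i + 1) - j) := by
      intro j
      induction j with
      | zero => intro _; simp [levelState, ih]
      | succ j ihj =>
        intro hj
        rw [← add_assoc, levelState, ihj (by omega), if_neg (by simp only; omega)]
        rw [Nat.sub_sub]
    rw [layerIndex, key _ le_rfl, Nat.sub_self]

theorem levelState_layerIndex_succ (i : ℕ) :
    levelState g (layerIndex g i + 1) = (i + 1, g (i + 1)) := by
  simp [levelState, levelState_layerIndex]

theorem levelState_fst_mono : Monotone fun k => (levelState g k).1 :=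
  monotone_nat_of_le_succ fun k => by
    simp only [levelState]; split_ifs <;> simp

theorem levelState_snd_le (h0 : g 0 = 0) (k : ℕ) :
    (levelState g k).2 ≤ g (levelState g k).1 := by
  induction k with
  | zero => simp [levelState, h0]
  | succ k ih => simp only [levelState]; split_ifs <;> simp only <;> omega

/-- The cut positions `a i` are compatible with the parent maps: unless an apex is inserted, the cut
continues at the first child of `a i`. -/
def IsCut (P : ℕ → ℤ → ℤ) (g : ℕ → ℕ) (a : ℕ → ℤ) : Prop :=
  ∀ i, g (i + 1) = 0 → ∀ y, a (i + 1) ≤ y ↔ a i ≤ P i y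

theorem add_intMul_of_degree {f : ℤ → ℤ} {N : ℕ} {d : ℕ} (hf : ∀ x, f (x + N) = f x + d)
    (x q : ℤ) : f (x + q * N) = f x + q * d := by
  induction q using Int.induction_on with
  | zero => simp
  | succ i ih => rw [add_mul, one_mul, ← add_assoc, hf, ih]; ring
  | pred i ih =>
    have := hf (x + (-i - 1) * N)
    rw [add_assoc, ← add_one_mul, sub_add_cancel, ih] at this
    linarith

variable {V : Type*} {G : SimpleGraph V} {Δ : ℕ} {vtx : ℕ → ℤ → V}

/-- As `P i` has degree one, a cut is also compatible with the parent maps one turn later. -/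
theorem IsCyclicChart.cut_lt_iff (hC : IsCyclicChart G Δ n vtx P) (ha : IsCut P g a) {i : ℕ}
    (hi : g (i + 1) = 0) (y : ℤ) :
    y < a (i + 1) + n (i + 1) ↔ P i y < a i + n i := by
  have h1 := ha i hi (y - n (i + 1))
  have h2 := hC.degree i (y - n (i + 1))
  rw [sub_add_cancel] at h2
  omega

/-- What `stripWidth` and `stripParent` are at each kind of level. -/
theorem strip_cases (h0 : g 0 = 0) (k : ℕ) :
    (∃ i, levelState g k = (i, 0) ∧ levelState g (k + 1) = (i + 1, 0) ∧ g (i + 1) = 0 ∧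
      stripWidth n g k = n i ∧ stripWidth n g (k + 1) = n (i + 1) ∧
      ∀ j, stripParent g P a k j = (P i (a (i + 1) + j) - a i).toNat) ∨
    (∃ i, levelState g k = (i, 0) ∧ levelState g (k + 1) = (i + 1, g (i + 1)) ∧ g (i + 1) ≠ 0 ∧
      stripWidth n g k = n i ∧ stripWidth n g (k + 1) = 1 ∧ ∀ j, stripParent g P a k j = 0) ∨
    (∃ i h, levelState g k = (i, h + 1) ∧ levelState g (k + 1) = (i, h) ∧ h + 1 < g i ∧
      stripWidth n g k = n i ∧ stripWidth n g (k + 1) = n i ∧ ∀ j, stripParent g P a k j = j) ∨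
    (∃ i h, levelState g k = (i + 1, h + 1) ∧ levelState g (k + 1) = (i + 1, h) ∧
      g (i + 1) = h + 1 ∧ stripWidth n g k = 1 ∧ stripWidth n g (k + 1) = n (i + 1) ∧
      ∀ j, stripParent g P a k j = 0) := by
  have hle := levelState_snd_le h0 k
  have hs : levelState g (k + 1) = if (levelState g k).2 = 0 then
      ((levelState g k).1 + 1, g ((levelState g k).1 + 1))
      else ((levelState g k).1, (levelState g k).2 - 1) := rfl
  rcases hst : levelState g k with ⟨i, h⟩
  rw [hst] at hle hs
  simp only at hle hs
  rcases h with _ | h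
  · rw [if_pos rfl] at hs
    by_cases hg : g (i + 1) = 0
    · left
      rw [hg] at hs
      exact ⟨i, rfl, hs, hg, by simp [stripWidth, hst], by simp [stripWidth, hs],
        fun j => by simp [stripParent, hst, hg]⟩
    · right; left
      exact ⟨i, rfl, hs, hg, by simp [stripWidth, hst], by simp [stripWidth, hs, hg],
        fun j => by simp [stripParent, hst, hg]⟩
  · rw [if_neg (by omega), Nat.add_sub_cancel] at hs
    rcases eq_or_lt_of_le hle with hg | hg
    · right; right; right
      rcases i with _ | i
      · omega
      refine ⟨i, h, rfl, hs, hg.symm, ?_, ?_, fun j => ?_⟩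
      · simp [stripWidth, hst, ← hg]
      · simp [stripWidth, hs, ← hg]
      · simp [stripParent, hst, ← hg]
    · right; right; left
      refine ⟨i, h, rfl, hs, hg, ?_, ?_, fun j => ?_⟩
      · simp [stripWidth, hst, hg]
      · simp only [stripWidth, hs]; rw [if_pos (by omega)]
      · simp [stripParent, hst, hg]

theorem IsCyclicChart.isLayerSeq_strip (hC : IsCyclicChart G Δ n vtx P) (h0 : g 0 = 0)
    (ha : IsCut P g a) : IsLayerSeq (stripWidth n g) (stripParent g P a) := by
  have hcut : ∀ i, g (i + 1) = 0 → ∀ j : ℕ, j < n (i + 1) →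
      0 ≤ P i (a (i + 1) + j) - a i ∧ P i (a (i + 1) + j) - a i < n i := by
    intro i hi j hj
    have h1 := (ha i hi (a (i + 1) + j)).1 (by omega)
    have h2 := (hC.cut_lt_iff ha hi (a (i + 1) + j)).1 (by omega)
    omega
  refine ⟨by simp [stripWidth, levelState, hC.n_zero], fun k => ?_, fun k j hj => ?_,
    fun k i j hij hj => ?_⟩
  · rw [stripWidth]; split_ifs
    · exact hC.n_pos _
    · exact one_pos
  · rcases strip_cases (n := n) (P := P) (a := a) h0 k with ⟨i, -, -, hg, hw, hw', hp⟩ |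
      ⟨i, -, -, hg, hw, hw', hp⟩ | ⟨i, h, -, -, hg, hw, hw', hp⟩ | ⟨i, h, -, -, hg, hw, hw', hp⟩
    · rw [hp, hw]; have := hcut i hg j (hw' ▸ hj); omega
    · rw [hp, hw]; exact hC.n_pos _
    · rw [hp, hw, ← hw']; exact hj
    · rw [hp, hw]; exact one_pos
  · rcases strip_cases (n := n) (P := P) (a := a) h0 k with ⟨l, -, -, hg, hw, hw', hp⟩ |
      ⟨l, -, -, hg, hw, hw', hp⟩ | ⟨l, h, -, -, hg, hw, hw', hp⟩ | ⟨l, h, -, -, hg, hw, hw', hp⟩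
    · rw [hp, hp]
      have := hC.mono l (show a (l + 1) + i ≤ a (l + 1) + j by omega)
      omega
    · rw [hp, hp]
    · rw [hp, hp]; exact hij
    · rw [hp, hp]

theorem IsCyclicChart.layerSurj_or_width_eq_one (hC : IsCyclicChart G Δ n vtx P) (h0 : g 0 = 0)
    (ha : IsCut P g a) (k : ℕ) :
    LayerSurj (stripWidth n g) (stripParent g P a) k ∨ stripWidth n g (k + 1) = 1 := by
  rcases strip_cases (n := n) (P := P) (a := a) h0 k with ⟨i, -, -, hg, hw, hw', hp⟩ |
    ⟨i, -, -, hg, hw, hw', hp⟩ | ⟨i, h, -, -, hg, hw, hw', hp⟩ | ⟨i, h, -, -, hg, hw, hw', hp⟩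
  · left
    intro t ht
    obtain ⟨y, hy⟩ := hC.surj i (a i + t)
    rw [hw] at ht
    have h1 := (ha i hg y).2 (by omega)
    have h2 := (hC.cut_lt_iff ha hg y).2 (by omega)
    refine ⟨(y - a (i + 1)).toNat, by omega, ?_⟩
    rw [hp, Int.toNat_of_nonneg (by omega), add_sub_cancel, hy]
    omega
  · exact Or.inr hw'
  · left
    intro t ht
    exact ⟨t, by rw [hw', ← hw]; exact ht, hp t⟩
  · left
    intro t ht
    exact ⟨0, by rw [hw']; exact hC.n_pos _, by rw [hp]; omega⟩

/-! ### Distances in a funnel -/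

/-- An upper bound for the diameter of the `i`-th layer: either go around the layer, or up to the
parents and around the previous layer. -/
def layerBound (n : ℕ → ℕ) : ℕ → ℕ
  | 0 => 1
  | i + 1 => min (n (i + 1)) (layerBound n i + 2)

theorem IsCyclicChart.width_mono (hC : IsCyclicChart G Δ n vtx P) (i : ℕ) :
    n i ≤ n (i + 1) := by
  by_contra hlt
  push Not at hlt
  obtain ⟨y, hy⟩ := hC.surj i 0
  choose f hf using fun j : ℤ => hC.surj i j
  -- Preimages of `0, …, n i - 1` would be that many integers between preimages of `0` and `n i`.
  have hmono : ∀ j : ℕ, f 0 + j ≤ f j := by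
    intro j
    induction j with
    | zero => simp
    | succ j ih =>
      have : f j < f (j + 1 : ℕ) := (hC.mono i).reflect_lt (by rw [hf, hf]; push_cast; omega)
      push_cast at this ⊢; omega
  have h1 := hmono (n i - 1)
  have h2 : f ((n i - 1 : ℕ) : ℤ) < f 0 + n (i + 1) :=
    (hC.mono i).reflect_lt (by rw [hf, hC.degree, hf]; have := hC.n_pos i; omega)
  omega

theorem IsCyclicChart.layerBound_le (hC : IsCyclicChart G Δ n vtx P) (i : ℕ) :
    layerBound n i ≤ n i := by
  cases i with
  | zero => exact hC.n_zero.ge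
  | succ i => exact min_le_left _ _

theorem IsCyclicChart.layerBound_le_succ (hC : IsCyclicChart G Δ n vtx P) (i : ℕ) :
    layerBound n i ≤ layerBound n (i + 1) :=
  le_min ((hC.layerBound_le i).trans (hC.width_mono i)) (by omega)

theorem layerBound_succ_le (n : ℕ → ℕ) (i : ℕ) : layerBound n (i + 1) ≤ layerBound n i + 2 :=
  min_le_right _ _

theorem IsCyclicChart.one_le_layerBound (hC : IsCyclicChart G Δ n vtx P) (i : ℕ) :
    1 ≤ layerBound n i := by
  induction i with
  | zero => exact le_rfl
  | succ i ih => exact ih.trans (hC.layerBound_le_succ i)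

theorem IsCyclicChart.edist_add_le (hC : IsCyclicChart G Δ n vtx P) {i : ℕ} (hi : i < Δ) (x : ℤ)
    (d : ℕ) : G.edist (vtx i x) (vtx i (x + d)) ≤ d := by
  induction d with
  | zero => simp
  | succ d ih =>
    refine (G.edist_triangle (v := vtx i (x + d))).trans ?_
    rw [Nat.cast_succ (R := ℕ∞)]
    refine add_le_add ih ?_
    rw [Nat.cast_succ, ← add_assoc, SimpleGraph.edist_le_one_iff_adj_or_eq]
    exact (hC.adj_succ i hi _).symm

theorem IsCyclicChart.edist_layer_le (hC : IsCyclicChart G Δ n vtx P) {i : ℕ} (hi : i < Δ)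
    (x y : ℤ) : G.edist (vtx i x) (vtx i y) ≤ layerBound n i := by
  have hround : ∀ i < Δ, ∀ x y : ℤ, G.edist (vtx i x) (vtx i y) ≤ n i := by
    intro i hi x y
    have hn : (0 : ℤ) < n i := by exact_mod_cast hC.n_pos i
    have h1 := Int.emod_nonneg (y - x) hn.ne'
    have h2 := Int.emod_lt_of_pos (y - x) hn
    have h3 : vtx i y = vtx i (x + ((y - x) % n i).toNat) := by
      rw [hC.eq_iff i hi i hi, Int.toNat_of_nonneg h1, ← sub_sub]
      exact ⟨rfl, Int.dvd_self_sub_emod⟩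
    rw [h3]
    refine (hC.edist_add_le hi x _).trans ?_
    exact_mod_cast (by omega : ((y - x) % n i).toNat ≤ n i)
  induction i generalizing x y with
  | zero => simpa [hC.n_zero, layerBound] using hround 0 hi x y
  | succ i ih =>
    rw [layerBound]
    rcases min_choice (n (i + 1)) (layerBound n i + 2) with h | h <;> rw [h]
    · exact hround _ hi x y
    have hx := (SimpleGraph.edist_le_one_iff_adj_or_eq).2 (Or.inl (hC.adj_parent i hi x))
    have hy := (SimpleGraph.edist_le_one_iff_adj_or_eq).2 (Or.inl (hC.adj_parent i hi y).symm)
    have := ih (by omega) (P i x) (P i y)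
    calc G.edist (vtx (i + 1) x) (vtx (i + 1) y)
        ≤ G.edist (vtx (i + 1) x) (vtx i (P i x)) + (G.edist (vtx i (P i x)) (vtx i (P i y)) +
          G.edist (vtx i (P i y)) (vtx (i + 1) y)) :=
          (G.edist_triangle (v := vtx i (P i x))).trans
            (add_le_add le_rfl (G.edist_triangle (v := vtx i (P i y))))
      _ ≤ 1 + (layerBound n i + 1) := add_le_add hx (add_le_add this hy)
      _ = ((layerBound n i + 2 : ℕ) : ℕ∞) := by
        rw [show layerBound n i + 2 = 1 + (layerBound n i + 1) by omega]; push_cast; rfl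

theorem IsCyclicChart.connected (hC : IsCyclicChart G Δ n vtx P) : G.Connected := by
  have key : ∀ i < Δ, ∀ x, G.Reachable (vtx i x) (vtx 0 0) := by
    intro i
    induction i with
    | zero =>
      intro hi x
      exact SimpleGraph.reachable_of_edist_ne_top
        (ne_top_of_le_ne_top (by simp) (hC.edist_layer_le hi x 0))
    | succ i ih =>
      intro hi x
      exact (hC.adj_parent i hi x).reachable.trans (ih (by omega) _)
  have : Nonempty V := ⟨vtx 0 0⟩
  refine ⟨fun x y => ?_⟩
  obtain ⟨i, hi, s, rfl⟩ := hC.cover x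
  obtain ⟨j, hj, t, rfl⟩ := hC.cover y
  exact (key i hi s).trans (key j hj t).symm

end Strips

/-! ### Distances in the strip graph -/

section StripDistance

variable {n g : ℕ → ℕ} {P : ℕ → ℤ → ℤ} {a : ℕ → ℤ}
variable {V : Type*} {G : SimpleGraph V} {Δ : ℕ} {vtx : ℕ → ℤ → V}

/-- The number of levels that are used. -/
abbrev stripHeight (g : ℕ → ℕ) (Δ : ℕ) : ℕ := layerIndex g (Δ - 1) + 1

/-- The graph that a funnel is cut into. -/
abbrev stripGraph (n g : ℕ → ℕ) (P : ℕ → ℤ → ℤ) (a : ℕ → ℤ) (Δ : ℕ) :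
    SimpleGraph (LayeredVertex (stripWidth n g) (stripHeight g Δ)) :=
  layeredGraph (stripWidth n g) (stripParent g P a) (stripHeight g Δ)

theorem layerIndex_strictMono : StrictMono (layerIndex g) :=
  strictMono_nat_of_lt_succ fun i => by rw [layerIndex]; omega

theorem stripWidth_layerIndex (i : ℕ) : stripWidth n g (layerIndex g i) = n i := by
  simp [stripWidth, levelState_layerIndex]

theorem levelState_fst_lt (hΔ : 0 < Δ) {k : ℕ} (hk : k < stripHeight g Δ) :
    (levelState g k).1 < Δ := by
  have := levelState_fst_mono (g := g) (Nat.le_of_lt_succ hk)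
  simp only [levelState_layerIndex] at this
  omega

theorem layerIndex_lt_stripHeight {i : ℕ} (hi : i < Δ) : layerIndex g i < stripHeight g Δ := by
  have := (layerIndex_strictMono (g := g)).monotone (show i ≤ Δ - 1 by omega)
  exact Nat.lt_succ_of_le this

theorem SimpleGraph.Walk.sub_le_length {W : Type*} {H : SimpleGraph W} {φ : W → ℤ}
    (hφ : ∀ x y, H.Adj x y → |φ x - φ y| ≤ 1) {x y : W} (w : H.Walk x y) :
    φ y - φ x ≤ w.length := by
  induction w with
  | nil => simp
  | cons h w ih =>
    have := abs_le.1 (hφ _ _ h)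
    rw [SimpleGraph.Walk.length_cons]; push_cast; omega

/-- The number in `[d - h, d + h]` closest to `A`, for `0 ≤ h`. It is used at height `h` in the
stack of copies of a layer, to interpolate between the value `d` at a vertex of the layer, where
`h = 0`, and the value `A` at the apex, where `h ≥ |d - A|`. -/
def clampDist (d A h : ℤ) : ℤ := max (d - h) (min (d + h) A)

theorem clampDist_zero (d A : ℤ) : clampDist d A 0 = d := by
  rw [clampDist]; omega

theorem clampDist_eq {d A h : ℤ} (hd : |d - A| ≤ h) : clampDist d A h = A := by
  rw [abs_le] at hd; rw [clampDist]; omega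

theorem abs_clampDist_sub_le {d d' A h : ℤ} (hd : |d - d'| ≤ 1) :
    |clampDist d A h - clampDist d' A h| ≤ 1 := by
  rw [abs_le] at hd; rw [clampDist, clampDist, abs_le]; omega

theorem abs_clampDist_succ_sub_le (d A h : ℤ) :
    |clampDist d A (h + 1) - clampDist d A h| ≤ 1 := by
  rw [clampDist, clampDist, abs_le]; omega

theorem SimpleGraph.Connected.abs_dist_sub_dist_le (hG : G.Connected) (u x y : V) :
    |(G.dist u x : ℤ) - G.dist u y| ≤ G.dist x y := by
  have h1 := hG.dist_triangle (u := u) (v := x) (w := y)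
  have h2 := hG.dist_triangle (u := u) (v := y) (w := x)
  rw [G.dist_comm (u := y)] at h2
  rw [abs_le]; omega

/-- For each vertex `u` of the funnel there is a 1-Lipschitz function on the strip graph that agrees
on the layers of the funnel with the distance from `u`. -/
theorem IsCyclicChart.exists_lipschitz (hC : IsCyclicChart G Δ n vtx P) (h0 : g 0 = 0)
    (ha : IsCut P g a)
    (hg : ∀ i, i + 1 < Δ → g (i + 1) ≠ 0 → ∀ x, G.dist (vtx (i + 1) x) (vtx i (a i)) < g (i + 1))
    (u : V) : ∃ φ : LayeredVertex (stripWidth n g) (stripHeight g Δ) → ℤ,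
      (∀ x y, (stripGraph n g P a Δ).Adj x y → |φ x - φ y| ≤ 1) ∧
      ∀ i (hi : i < Δ) j (hj : j < n i), φ ⟨(layerIndex g i, j), layerIndex_lt_stripHeight hi,
        by rw [stripWidth_layerIndex]; exact hj⟩ = G.dist u (vtx i (a i + j)) := by
  have hconn := hC.connected
  let d : ℕ → ℤ → ℤ := fun i x => G.dist u (vtx i x)
  -- An apex above layer `i` gets the value of its parent, the first vertex of layer `i - 1`.
  let A : ℕ → ℤ := fun i => d (i - 1) (a (i - 1))
  let φ : ℕ × ℕ → ℤ := fun z =>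
    clampDist (d (levelState g z.1).1 (a (levelState g z.1).1 + z.2)) (A (levelState g z.1).1)
      (levelState g z.1).2
  have hlip : ∀ i j x y, G.Adj (vtx i x) (vtx j y) → |d i x - d j y| ≤ 1 := by
    intro i j x y h
    refine (hconn.abs_dist_sub_dist_le u _ _).trans ?_
    rw [SimpleGraph.dist_eq_one_iff_adj.2 h]; rfl
  have hsucc : ∀ i < Δ, ∀ x, |d i x - d i (x + 1)| ≤ 1 := by
    intro i hi x
    rcases hC.adj_succ i hi x with h | h
    · simp only [d, ← h]; simp
    · exact hlip _ _ _ _ h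
  have hapex : ∀ i, i + 1 < Δ → g (i + 1) ≠ 0 → ∀ x, |d (i + 1) x - A (i + 1)| < g (i + 1) := by
    intro i hi hgi x
    refine (hconn.abs_dist_sub_dist_le u _ _).trans_lt ?_
    exact_mod_cast hg i hi hgi x
  have hstep : ∀ x y : LayeredVertex (stripWidth n g) (stripHeight g Δ),
      LayeredStep (stripParent g P a) x.1 y.1 → |φ x.1 - φ y.1| ≤ 1 := by
    rintro ⟨⟨k, j⟩, hk, hj⟩ ⟨⟨k', j'⟩, hk', hj'⟩ hxy
    have hkΔ := levelState_fst_lt hC.pos hk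
    have hkΔ' := levelState_fst_lt hC.pos hk'
    rcases hxy with ⟨h1, h2⟩ | ⟨h1, h2⟩
    · simp only at h1 h2
      subst h1 h2
      refine abs_clampDist_sub_le ?_
      push_cast
      rw [← add_assoc]
      exact hsucc _ hkΔ _
    · simp only at h1 h2
      subst h1
      simp only [φ]
      rcases strip_cases (n := n) (P := P) (a := a) h0 k with
        ⟨i, hs, hs', hgi, hw, hw', hp⟩ | ⟨i, hs, hs', hgi, hw, hw', hp⟩ |
        ⟨i, h, hs, hs', hgi, hw, hw', hp⟩ | ⟨i, h, hs, hs', hgi, hw, hw', hp⟩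
      · simp only [hs, hs', hp] at h2 hkΔ' ⊢
        have h3 := (ha i hgi (a (i + 1) + j')).1 (by omega)
        rw [Nat.cast_zero, clampDist_zero, clampDist_zero, h2, Int.toNat_of_nonneg (by omega),
          add_sub_cancel]
        exact hlip _ _ _ _ (hC.adj_parent i hkΔ' _).symm
      · simp only [hs, hs', hp] at h2 hkΔ' ⊢
        subst h2
        rw [Nat.cast_zero, clampDist_zero, clampDist_eq (hapex i hkΔ' hgi _).le]
        simp [A]
      · simp only [hs, hs', hp] at h2 ⊢
        subst h2
        push_cast
        exact abs_clampDist_succ_sub_le _ _ _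
      · simp only [hs, hs', hp] at h2 hkΔ' ⊢
        have h3 := fun x => hapex i hkΔ' (by omega) x
        simp only [hgi] at h3
        rw [clampDist_eq (h3 _).le, clampDist_eq]
        · simp
        · have := h3 (a (i + 1) + j')
          push_cast at this; omega
  refine ⟨fun z => φ z.1, fun x y hxy => ?_, fun i hi j hj => ?_⟩
  · rcases hxy with h | h
    · exact hstep x y h
    · rw [abs_sub_comm]; exact hstep y x h
  · simp only [φ, levelState_layerIndex, Nat.cast_zero, clampDist_zero, d]

/-- The position of `vtx i x` in the `i`-th layer, counted from the cut position `a i`. -/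
def cutPosition (n : ℕ → ℕ) (a : ℕ → ℤ) (i : ℕ) (x : ℤ) : ℕ := ((x - a i) % n i).toNat

theorem IsCyclicChart.cutPosition_cast (hC : IsCyclicChart G Δ n vtx P) (a : ℕ → ℤ) (i : ℕ)
    (x : ℤ) : (cutPosition n a i x : ℤ) = (x - a i) % n i :=
  Int.toNat_of_nonneg (Int.emod_nonneg _ (by exact_mod_cast (hC.n_pos i).ne'))

theorem IsCyclicChart.cutPosition_lt (hC : IsCyclicChart G Δ n vtx P) (a : ℕ → ℤ) (i : ℕ)
    (x : ℤ) : cutPosition n a i x < n i := by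
  have h1 := hC.cutPosition_cast a i x
  have h2 := Int.emod_lt_of_pos (x - a i) (b := (n i : ℤ)) (by exact_mod_cast hC.n_pos i)
  omega

theorem IsCyclicChart.vtx_cutPosition (hC : IsCyclicChart G Δ n vtx P) (a : ℕ → ℤ) {i : ℕ}
    (hi : i < Δ) (x : ℤ) : vtx i (a i + cutPosition n a i x) = vtx i x := by
  rw [hC.eq_iff i hi i hi, hC.cutPosition_cast, ← dvd_neg, neg_sub, ← sub_sub]
  exact ⟨rfl, Int.dvd_self_sub_emod⟩

theorem cutPosition_congr (a : ℕ → ℤ) {i : ℕ} {x y : ℤ} (h : (n i : ℤ) ∣ x - y) :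
    cutPosition n a i x = cutPosition n a i y := by
  rw [cutPosition, cutPosition]
  congr 1
  rw [Int.emod_eq_emod_iff_emod_sub_eq_zero, ← Int.dvd_iff_emod_eq_zero]
  simpa using h

theorem IsCyclicChart.cutPosition_succ (hC : IsCyclicChart G Δ n vtx P) (a : ℕ → ℤ) {i : ℕ}
    {x : ℤ} (hx : ¬ (n i : ℤ) ∣ x + 1 - a i) :
    cutPosition n a i (x + 1) = cutPosition n a i x + 1 := by
  have hn : (0 : ℤ) < n i := by exact_mod_cast hC.n_pos i
  have h1 := hC.cutPosition_cast a i x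
  have h2 := hC.cutPosition_cast a i (x + 1)
  have h3 := Int.emod_nonneg (x - a i) hn.ne'
  have h4 := Int.emod_lt_of_pos (x - a i) hn
  have h5 : (x + 1 - a i) % n i = ((x - a i) % n i + 1) % n i := by
    rw [Int.emod_add_emod]; congr 1; ring
  rw [Int.dvd_iff_emod_eq_zero] at hx
  rw [h5] at hx
  rcases eq_or_lt_of_le (Int.add_one_le_of_lt h4) with h6 | h6
  · rw [h6, Int.emod_self] at hx; exact absurd rfl hx
  · rw [Int.emod_eq_of_lt (by omega) h6] at h5; omega

theorem IsCyclicChart.cutPosition_parent (hC : IsCyclicChart G Δ n vtx P) (ha : IsCut P g a)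
    {i : ℕ} (hi : g (i + 1) = 0) (x : ℤ) :
    cutPosition n a i (P i x) =
      (P i (a (i + 1) + cutPosition n a (i + 1) x) - a i).toNat := by
  rw [cutPosition]
  congr 1
  have h1 := hC.cutPosition_cast a (i + 1) x
  have h2 := hC.cutPosition_lt a (i + 1) x
  set c := cutPosition n a (i + 1) x
  have h3 := (ha i hi (a (i + 1) + c)).1 (by omega)
  have h4 := (hC.cut_lt_iff ha hi (a (i + 1) + c)).1 (by omega)
  have h5 : x = a (i + 1) + c + (x - a (i + 1)) / n (i + 1) * n (i + 1) := by
    have := Int.emod_add_mul_ediv (x - a (i + 1)) (n (i + 1))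
    rw [h1, mul_comm]; linarith
  have h6 := add_intMul_of_degree (hC.degree i) (a (i + 1) + c) ((x - a (i + 1)) / n (i + 1))
  rw [← h5] at h6
  rw [h6, add_sub_right_comm, Int.add_mul_emod_self_right]
  exact Int.emod_eq_of_lt (by omega) (by omega)

section UpperBounds

variable {m : ℕ → ℕ} {p : ℕ → ℕ → ℕ} {L : ℕ}

/-- Any two vertices of the `k`-th layer of a layered graph have distance at most `r`. -/
def LayerDiamLE (m : ℕ → ℕ) (p : ℕ → ℕ → ℕ) (L k r : ℕ) : Prop :=
  ∀ x y : LayeredVertex m L, x.1.1 = k → y.1.1 = k → (layeredGraph m p L).edist x y ≤ r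

theorem layerDiamLE_width (k : ℕ) : LayerDiamLE m p L k (m k) := by
  have key : ∀ d j (hk : k < L) (hj : j + d < m k), (layeredGraph m p L).edist
      ⟨(k, j), hk, by simp only; omega⟩ ⟨(k, j + d), hk, hj⟩ ≤ d := by
    intro d
    induction d with
    | zero => intro j hk hj; simp
    | succ d ih =>
      intro j hk hj
      refine ((layeredGraph m p L).edist_triangle (v := ⟨(k, j + d), hk, by
        simp only; omega⟩)).trans ?_
      rw [Nat.cast_succ]
      refine add_le_add (ih j hk (by omega)) ?_
      rw [SimpleGraph.edist_le_one_iff_adj_or_eq]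
      exact Or.inl (layeredGraph_adj_succ k (j + d) hk hj)
  rintro ⟨⟨k₁, i⟩, hk₁, hi⟩ ⟨⟨k₂, j⟩, hk₂, hj⟩ h1 h2
  simp only at h1 h2 hi hj hk₁
  subst h1 h2
  rcases le_total i j with hij | hij
  · obtain ⟨d, rfl⟩ := Nat.exists_eq_add_of_le hij
    exact (key d i hk₁ hj).trans (by exact_mod_cast (by omega : d ≤ m k₂))
  · obtain ⟨d, rfl⟩ := Nat.exists_eq_add_of_le hij
    rw [SimpleGraph.edist_comm]
    exact (key d j hk₁ hi).trans (by exact_mod_cast (by omega : d ≤ m k₂))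

theorem exists_parent (h : IsLayerSeq m p) {k : ℕ} (x : LayeredVertex m L) (hx : x.1.1 = k + 1) :
    ∃ y : LayeredVertex m L, y.1.1 = k ∧ (layeredGraph m p L).edist x y ≤ 1 := by
  obtain ⟨⟨l, j⟩, hl, hj⟩ := x
  simp only at hx hl hj
  subst hx
  refine ⟨⟨(k, p k j), by simp only; omega, h.lt k j hj⟩, rfl, ?_⟩
  exact SimpleGraph.edist_le_one_iff_adj_or_eq.2 (Or.inl (layeredGraph_adj_parent h k j hl hj))

theorem exists_ancestor (h : IsLayerSeq m p) {k d : ℕ} (x : LayeredVertex m L)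
    (hx : x.1.1 = k + d) :
    ∃ y : LayeredVertex m L, y.1.1 = k ∧ (layeredGraph m p L).edist x y ≤ d := by
  induction d generalizing x with
  | zero => exact ⟨x, hx, by simp⟩
  | succ d ih =>
    obtain ⟨y, hy, hxy⟩ := exists_parent h x (k := k + d) hx
    obtain ⟨z, hz, hyz⟩ := ih y hy
    refine ⟨z, hz, (SimpleGraph.edist_triangle (v := y)).trans ?_⟩
    rw [Nat.cast_succ, add_comm]
    exact add_le_add hyz hxy

theorem LayerDiamLE.add (h : IsLayerSeq m p) {k r : ℕ} (hr : LayerDiamLE m p L k r) (d : ℕ) :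
    LayerDiamLE m p L (k + d) (r + 2 * d) := by
  intro x y hx hy
  obtain ⟨x', hx', hxx⟩ := exists_ancestor h x hx
  obtain ⟨y', hy', hyy⟩ := exists_ancestor h y hy
  rw [SimpleGraph.edist_comm] at hyy
  refine (SimpleGraph.edist_triangle (v := x')).trans ?_
  rw [show r + 2 * d = d + (r + d) by omega, Nat.cast_add, Nat.cast_add]
  refine add_le_add hxx ((SimpleGraph.edist_triangle (v := y')).trans ?_)
  exact add_le_add (hr x' y' hx' hy') hyy

theorem LayerDiamLE.mono {k r s : ℕ} (hr : LayerDiamLE m p L k r) (hrs : r ≤ s) :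
    LayerDiamLE m p L k s :=
  fun x y hx hy => (hr x y hx hy).trans (by exact_mod_cast hrs)

end UpperBounds

/-- In the strip graph, too, the diameter of the `i`-th layer is `O(layerBound n i)`, if the apices
are at heights of this order: two vertices of a layer are joined along the layer, or by way of the
previous layer, or by way of the apex. -/
theorem IsCyclicChart.layerDiamLE_strip (hC : IsCyclicChart G Δ n vtx P) (h0 : g 0 = 0)
    (ha : IsCut P g a) (hg : ∀ i, g i ≠ 0 → g i = layerBound n i + 2) (L i : ℕ) :
    LayerDiamLE (stripWidth n g) (stripParent g P a) L (layerIndex g i)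
      (3 * layerBound n i + 4) := by
  have hseq := hC.isLayerSeq_strip h0 ha
  induction i with
  | zero =>
    refine (layerDiamLE_width _).mono ?_
    rw [stripWidth_layerIndex, hC.n_zero]; omega
  | succ i ih =>
    rw [layerIndex]
    have h1 := hC.one_le_layerBound i
    by_cases hgi : g (i + 1) = 0
    · rcases le_total (n (i + 1)) (layerBound n i + 2) with h | h
      · have := stripWidth_layerIndex (n := n) (g := g) (i + 1)
        rw [layerIndex] at this
        refine (layerDiamLE_width _).mono ?_
        rw [this, layerBound, min_eq_left h]; omega
      · rw [hgi, add_zero]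
        refine (ih.add hseq 1).mono ?_
        rw [layerBound, min_eq_right h]; omega
    · have hapex : LayerDiamLE (stripWidth n g) (stripParent g P a) L (layerIndex g i + 1) 1 := by
        have := layerDiamLE_width (m := stripWidth n g) (p := stripParent g P a) (L := L)
          (layerIndex g i + 1)
        rwa [stripWidth, levelState_layerIndex_succ, if_neg (by simp [hgi])] at this
      refine (hapex.add hseq (g (i + 1))).mono ?_
      have := hC.one_le_layerBound (i + 1)
      rw [hg _ hgi]; omega

/-- The strip graph is a repeated 1-sum of pyramids, the funnel embeds into it without contraction,
all its edges are preserved, except for those at the cut positions and those interrupted by an apex,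
whose length is of the order of `layerBound`. -/
theorem IsCyclicChart.exists_strip_embedding (hC : IsCyclicChart G Δ n vtx P) (h0 : g 0 = 0)
    (ha : IsCut P g a) (hg : ∀ i, g i ≠ 0 → g i = layerBound n i + 2) :
    ∃ (W : Type) (H : SimpleGraph W) (f : V → W),
      OneSumClosure (fun _ H => IsPyramid H) W H ∧
      (∀ x y, G.edist x y ≤ H.edist (f x) (f y)) ∧
      (∀ i < Δ, ∀ x, H.edist (f (vtx i x)) (f (vtx i (x + 1))) ≤ (3 * layerBound n i + 4 : ℕ)) ∧
      (∀ i < Δ, ∀ x, ¬ (n i : ℤ) ∣ x + 1 - a i →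
        H.edist (f (vtx i x)) (f (vtx i (x + 1))) ≤ 1) ∧
      (∀ i, i + 1 < Δ → ∀ x, H.edist (f (vtx (i + 1) x)) (f (vtx i (P i x))) ≤
        (11 * layerBound n (i + 1) : ℕ)) ∧
      (∀ i, i + 1 < Δ → ∀ x, g (i + 1) = 0 →
        H.edist (f (vtx (i + 1) x)) (f (vtx i (P i x))) ≤ 1) := by
  have hseq := hC.isLayerSeq_strip h0 ha
  choose lev hlev crd hcrd using hC.cover
  let f : V → LayeredVertex (stripWidth n g) (stripHeight g Δ) := fun y =>
    ⟨(layerIndex g (lev y), cutPosition n a (lev y) (crd y)), layerIndex_lt_stripHeight (hlev y),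
      by rw [stripWidth_layerIndex]; exact hC.cutPosition_lt _ _ _⟩
  have hf : ∀ i < Δ, ∀ x, (f (vtx i x)).1 = (layerIndex g i, cutPosition n a i x) := by
    intro i hi x
    have h := (hC.eq_iff _ (hlev (vtx i x)) i hi _ _).1 (hcrd (vtx i x))
    have h2 := cutPosition_congr a h.2
    simp only [f]
    rw [h2, h.1]
  have hdiam := hC.layerDiamLE_strip h0 ha hg (stripHeight g Δ)
  refine ⟨_, stripGraph n g P a Δ, f, layeredGraph_mem_oneSumClosure hseq (Nat.succ_pos _)
    (fun k _ => hC.layerSurj_or_width_eq_one h0 ha k), ?_, ?_, ?_, ?_, ?_⟩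
  · intro u w
    -- The apex hangs below `vtx i (a i)`, which must be closer to layer `i + 1` than the apex is.
    have hlt : ∀ i, i + 1 < Δ → g (i + 1) ≠ 0 → ∀ x,
        G.dist (vtx (i + 1) x) (vtx i (a i)) < g (i + 1) := by
      intro i hi hgi x
      have h1 : G.edist (vtx (i + 1) x) (vtx i (a i)) ≤ (1 + layerBound n i : ℕ) := by
        refine (SimpleGraph.edist_triangle (v := vtx i (P i x))).trans ?_
        push_cast
        exact add_le_add (SimpleGraph.edist_le_one_iff_adj_or_eq.2
          (Or.inl (hC.adj_parent i hi x))) (hC.edist_layer_le (by omega) _ _)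
      rw [← (hC.connected _ _).coe_dist_eq_edist] at h1
      have h2 : G.dist (vtx (i + 1) x) (vtx i (a i)) ≤ 1 + layerBound n i := by exact_mod_cast h1
      have := hC.layerBound_le_succ i
      rw [hg _ hgi]; omega
    obtain ⟨φ, hφ, hφd⟩ := hC.exists_lipschitz h0 ha hlt u
    by_cases htop : (stripGraph n g P a Δ).edist (f u) (f w) = ⊤
    · rw [htop]; exact le_top
    obtain ⟨p, hp⟩ := SimpleGraph.exists_walk_of_edist_ne_top htop
    have hval : ∀ y, φ (f y) = G.dist u y := by
      intro y
      rw [hφd _ (hlev y) _ (hC.cutPosition_lt _ _ _), hC.vtx_cutPosition a (hlev y), hcrd]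
    have := p.sub_le_length hφ
    rw [hval, hval, SimpleGraph.dist_self] at this
    rw [← hp, ← (hC.connected u w).coe_dist_eq_edist]
    exact_mod_cast (by omega : G.dist u w ≤ p.length)
  · intro i hi x
    exact hdiam i _ _ (by rw [hf i hi]) (by rw [hf i hi])
  · intro i hi x hx
    refine SimpleGraph.edist_le_one_iff_adj_or_eq.2 (Or.inl (Or.inl (Or.inl ?_)))
    rw [hf i hi, hf i hi]
    exact ⟨rfl, hC.cutPosition_succ a hx⟩
  · intro i hi x
    obtain ⟨y, hy, hxy⟩ := exists_ancestor hseq (f (vtx (i + 1) x)) (k := layerIndex g i)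
      (d := 1 + g (i + 1)) (by rw [hf _ hi, layerIndex]; omega)
    refine (SimpleGraph.edist_triangle (v := y)).trans
      ((add_le_add hxy (hdiam i y _ hy (by rw [hf i (by omega)]))).trans ?_)
    have h1 := hC.layerBound_le_succ i
    have h2 := hC.one_le_layerBound i
    have h3 : g (i + 1) ≤ layerBound n (i + 1) + 2 := by
      by_cases hgi : g (i + 1) = 0
      · omega
      · rw [hg _ hgi]
    exact_mod_cast (by omega :
      1 + g (i + 1) + (3 * layerBound n i + 4) ≤ 11 * layerBound n (i + 1))
  · intro i hi x hgi
    refine SimpleGraph.edist_le_one_iff_adj_or_eq.2 (Or.inl (Or.inr (Or.inr ?_)))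
    rw [hf _ hi, hf i (by omega)]
    refine ⟨by simp only [layerIndex, hgi, add_zero], ?_⟩
    simp only
    rw [stripParent, levelState_layerIndex, if_pos rfl, if_pos hgi]
    exact hC.cutPosition_parent ha hgi x

end StripDistance

/-! ### Random cuts -/

section RandomCut

/-- The scale of the `i`-th layer: `layerBound n i` is about `4 ^ layerScale n i`. -/
def layerScale (n : ℕ → ℕ) (i : ℕ) : ℕ := Nat.log 4 (layerBound n i)

/-- The first layer whose scale is at least `r`. -/
noncomputable def scaleStart (n : ℕ → ℕ) (r : ℕ) : ℕ := sInf {i | 4 ^ r ≤ layerBound n i}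

/-- The layer above which an apex is inserted at scale `r`: it is uniform among the first `4 ^ r`
layers of this scale if `U` is uniform modulo `4 ^ r`. -/
noncomputable def apexLayer (n : ℕ → ℕ) (U r : ℕ) : ℕ := scaleStart n r + U % 4 ^ r

/-- The number of auxiliary levels above the `i`-th layer. The basepoint gets none. -/
noncomputable def apexHeight (n : ℕ → ℕ) (U i : ℕ) : ℕ :=
  if i ≠ 0 ∧ i = apexLayer n U (layerScale n i) then layerBound n i + 2 else 0

/-- The scale whose cut is used in the `i`-th layer: until the apex of a scale is inserted, the cut
of the previous scale is continued. At scale `0` the first case applies, as `apexLayer n U 0 = 0`.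
-/
noncomputable def cutScale (n : ℕ → ℕ) (U i : ℕ) : ℕ :=
  if apexLayer n U (layerScale n i) ≤ i then layerScale n i else layerScale n i - 1

/-- The cut that starts at position `U` of layer `s` and follows first children, given by `F`. -/
def cutLine (F : ℕ → ℤ → ℤ) (U s : ℕ) : ℕ → ℤ
  | 0 => U
  | i + 1 => if i + 1 ≤ s then U else F i (cutLine F U s i)

variable {n : ℕ → ℕ} {P : ℕ → ℤ → ℤ} {V : Type*} {G : SimpleGraph V} {Δ : ℕ} {vtx : ℕ → ℤ → V}

/-- The map to first children: `F i b` is the first position in layer `i + 1` whose parent is at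
least `b`, so that `F i` is left adjoint to `P i`. -/
theorem IsCyclicChart.exists_firstChild (hC : IsCyclicChart G Δ n vtx P) :
    ∃ F : ℕ → ℤ → ℤ, ∀ i b y, F i b ≤ y ↔ b ≤ P i y := by
  have key : ∀ i b, ∃ z, ∀ y, z ≤ y ↔ b ≤ P i y := by
    intro i b
    obtain ⟨y₀, hy₀⟩ := hC.surj i (b - 1)
    obtain ⟨y₁, hy₁⟩ := hC.surj i b
    obtain ⟨z, hz, hmin⟩ := Int.exists_least_of_bdd (P := fun y => b ≤ P i y)
      ⟨y₀, fun y hy => (hC.mono i).reflect_lt (by omega) |>.le⟩ ⟨y₁, hy₁.ge⟩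
    exact ⟨z, fun y => ⟨fun h => hz.trans (hC.mono i h), hmin y⟩⟩
  choose F hF using key
  exact ⟨F, hF⟩

theorem IsCyclicChart.layerBound_mono (hC : IsCyclicChart G Δ n vtx P) :
    Monotone (layerBound n) :=
  monotone_nat_of_le_succ hC.layerBound_le_succ

theorem IsCyclicChart.pow_layerScale_le (hC : IsCyclicChart G Δ n vtx P) (i : ℕ) :
    4 ^ layerScale n i ≤ layerBound n i :=
  Nat.pow_log_le_self 4 (by have := hC.one_le_layerBound i; omega)

theorem layerBound_lt_pow (n : ℕ → ℕ) (i : ℕ) : layerBound n i < 4 ^ (layerScale n i + 1) :=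
  Nat.lt_pow_succ_log_self (by norm_num) _

theorem IsCyclicChart.pow_le_of_le_layerScale (hC : IsCyclicChart G Δ n vtx P) {r i : ℕ}
    (hr : r ≤ layerScale n i) : 4 ^ r ≤ layerBound n i :=
  (Nat.pow_le_pow_right (by norm_num) hr).trans (hC.pow_layerScale_le i)

theorem IsCyclicChart.scaleStart_le (hC : IsCyclicChart G Δ n vtx P) {r i : ℕ}
    (hr : r ≤ layerScale n i) : scaleStart n r ≤ i :=
  Nat.sInf_le (hC.pow_le_of_le_layerScale hr)

theorem IsCyclicChart.pow_le_layerBound_scaleStart (hC : IsCyclicChart G Δ n vtx P) {r i : ℕ}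
    (hr : r ≤ layerScale n i) : 4 ^ r ≤ layerBound n (scaleStart n r) :=
  Nat.sInf_mem (s := {i | 4 ^ r ≤ layerBound n i}) ⟨i, hC.pow_le_of_le_layerScale hr⟩

theorem layerBound_scaleStart_le (n : ℕ → ℕ) (r : ℕ) :
    layerBound n (scaleStart n r) ≤ 4 ^ r + 1 := by
  rcases h : scaleStart n r with _ | j
  · simp [layerBound]
  · have h1 : layerBound n j < 4 ^ r := by
      by_contra hcon
      have : scaleStart n r ≤ j := Nat.sInf_le (not_lt.1 hcon)
      omega
    have := layerBound_succ_le n j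
    omega

theorem layerBound_add_le (n : ℕ → ℕ) (i k : ℕ) :
    layerBound n (i + k) ≤ layerBound n i + 2 * k := by
  induction k with
  | zero => simp
  | succ k ih => have := layerBound_succ_le n (i + k); rw [← add_assoc]; omega

theorem IsCyclicChart.layerScale_le_succ (hC : IsCyclicChart G Δ n vtx P) (i : ℕ) :
    layerScale n i ≤ layerScale n (i + 1) :=
  Nat.log_mono_right (hC.layerBound_le_succ i)

theorem layerScale_succ_le (n : ℕ → ℕ) (i : ℕ) :
    layerScale n (i + 1) ≤ layerScale n i + 1 := by
  have h1 := layerBound_lt_pow n i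
  have h2 := layerBound_succ_le n i
  refine Nat.le_of_lt_succ (Nat.log_lt_of_lt_pow' (by omega) ?_)
  have h3 : 1 ≤ 4 ^ (layerScale n i + 1) := Nat.one_le_pow _ _ (by norm_num)
  rw [pow_succ _ (layerScale n i + 1)]
  omega

theorem cutScale_le (U i : ℕ) : cutScale n U i ≤ layerScale n i := by
  rw [cutScale]; split_ifs <;> omega

/-- A scale lasts long enough for its apex to be inserted before the next scale begins. -/
theorem IsCyclicChart.apexLayer_le_of_layerScale_lt (hC : IsCyclicChart G Δ n vtx P) (U : ℕ) {i : ℕ}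
    (hi : layerScale n i < layerScale n (i + 1)) : apexLayer n U (layerScale n i) ≤ i := by
  set r := layerScale n i
  have h1 : scaleStart n r ≤ i := hC.scaleStart_le le_rfl
  have h2 : 4 ^ (r + 1) ≤ layerBound n (i + 1) := hC.pow_le_of_le_layerScale hi
  have h3 := layerBound_scaleStart_le n r
  have h4 := layerBound_add_le n (scaleStart n r) (i + 1 - scaleStart n r)
  rw [Nat.add_sub_cancel' (by omega)] at h4
  have h5 : 0 < 4 ^ r := by positivity
  have h6 := Nat.mod_lt U h5
  rw [pow_succ] at h2
  rw [apexLayer]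
  omega

/-- Below an inserted apex and up to the next one the same cut is used. -/
theorem IsCyclicChart.cutScale_succ (hC : IsCyclicChart G Δ n vtx P) {U i : ℕ}
    (hi : i + 1 ≠ apexLayer n U (layerScale n (i + 1))) :
    cutScale n U (i + 1) = cutScale n U i := by
  rcases eq_or_lt_of_le (hC.layerScale_le_succ i) with h | h
  · rw [cutScale, cutScale, ← h]
    rw [← h] at hi
    split_ifs <;> omega
  · have h1 := hC.apexLayer_le_of_layerScale_lt U h
    have h2 : layerScale n (i + 1) = layerScale n i + 1 :=
      le_antisymm (layerScale_succ_le n i) h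
    have h3 : i < scaleStart n (layerScale n i + 1) := by
      by_contra hcon
      have h4 := hC.layerBound_mono (not_lt.1 hcon)
      have h5 := hC.pow_le_layerBound_scaleStart (r := layerScale n i + 1) (i := i + 1) h2.ge
      have h6 := layerBound_lt_pow n i
      omega
    have h4 : i + 1 ≤ apexLayer n U (layerScale n i + 1) :=
      le_trans (Nat.succ_le_of_lt h3) (Nat.le_add_right _ _)
    rw [h2] at hi
    rw [cutScale, cutScale, h2, if_neg (by omega), if_pos h1, Nat.add_sub_cancel]

/-- The cuts of the different scales, each used in its own layers, fit together since an apex is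
inserted wherever the scale in use changes. -/
theorem IsCyclicChart.isCut (hC : IsCyclicChart G Δ n vtx P) {F : ℕ → ℤ → ℤ}
    (hF : ∀ i b y, F i b ≤ y ↔ b ≤ P i y) (U : ℕ) :
    IsCut P (apexHeight n U) fun i => cutLine F U (scaleStart n (cutScale n U i)) i := by
  intro i hi y
  have h1 : i + 1 ≠ apexLayer n U (layerScale n (i + 1)) := by
    intro h
    rw [apexHeight, if_pos ⟨by omega, h⟩] at hi
    omega
  have h2 : scaleStart n (cutScale n U i) ≤ i := hC.scaleStart_le (cutScale_le U i)
  beta_reduce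
  rw [hC.cutScale_succ h1, cutLine, if_neg (by omega), hF]

/-- A cut passes through a given position of layer `i` for at most one starting position modulo
`n s`, as it can be traced back along the parents. -/
theorem IsCyclicChart.exists_cutLine_start (hC : IsCyclicChart G Δ n vtx P) {F : ℕ → ℤ → ℤ}
    (hF : ∀ i b y, F i b ≤ y ↔ b ≤ P i y) {s i : ℕ} (hi : s ≤ i) (y : ℤ) :
    ∃ R : ℤ, ∀ U : ℕ, (n i : ℤ) ∣ y - cutLine F U s i → (n s : ℤ) ∣ R - U := by
  induction i, hi using Nat.le_induction generalizing y with
  | base =>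
    refine ⟨y, fun U h => ?_⟩
    have : cutLine F U s s = U := by
      cases s with
      | zero => rfl
      | succ s => rw [cutLine, if_pos le_rfl]
    rwa [this] at h
  | succ i hi ih =>
    obtain ⟨R, hR⟩ := ih (P i y)
    refine ⟨R, fun U h => hR U ?_⟩
    rw [cutLine, if_neg (by omega)] at h
    obtain ⟨q, hq⟩ := h
    have hPF : P i (F i (cutLine F U s i)) = cutLine F U s i := by
      refine le_antisymm ?_ ((hF i _ _).1 le_rfl)
      obtain ⟨z, hz⟩ := hC.surj i (cutLine F U s i)
      calc P i (F i (cutLine F U s i)) ≤ P i z := hC.mono i ((hF i _ _).2 hz.ge)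
        _ = cutLine F U s i := hz
    have h1 : y = F i (cutLine F U s i) + q * n (i + 1) := by rw [mul_comm]; omega
    rw [h1, add_intMul_of_degree (hC.degree i), hPF]
    exact ⟨q, by ring⟩

/-- A uniformly random element of `Fin N` lies in a given residue class modulo a divisor `m` of `N`
with probability at most `1 / m`. -/
theorem card_filter_dvd_mul_le {N m : ℕ} (hm : m ∣ N) (R : ℤ)
    (B : Fin N → Prop) [DecidablePred B] (hB : ∀ U, B U → (m : ℤ) ∣ R - (U : ℕ)) :
    (Finset.univ.filter B).card * m ≤ N := by
  obtain ⟨k, rfl⟩ := hm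
  have : (Finset.univ.filter B).card ≤ (Finset.range k).card := by
    refine Finset.card_le_card_of_injOn (fun U => U.val / m) (fun U _ => ?_) ?_
    · have := U.2
      simp only [Finset.coe_range, Set.mem_Iio]
      exact Nat.div_lt_of_lt_mul this
    · intro U hU U' hU' h
      simp only [Finset.coe_filter, Finset.mem_univ, true_and, Set.mem_ofPred_eq] at hU hU'
      have h1 : (m : ℤ) ∣ (U' : ℕ) - (U : ℕ) := by
        have := dvd_sub (hB U hU) (hB U' hU')
        simpa using this
      have h2 : U.val % m = U'.val % m := (Nat.modEq_iff_dvd.2 h1)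
      have h3 := Nat.div_add_mod U.val m
      have h4 := Nat.div_add_mod U'.val m
      simp only at h
      rw [h, h2] at h3
      exact Fin.ext (h3.symm.trans h4)
  rw [Finset.card_range] at this
  rw [mul_comm]
  exact Nat.mul_le_mul_left m this

/-- If a random distance is at most `1` off an event and at most `K` on it, and the event has
probability at most `κ / K`, then the expected distance is at most `1 + κ`. -/
theorem expectation_le {N : ℕ} (hN : 0 < N) (e : Fin N → ℕ∞) (B : Fin N → Prop) [DecidablePred B]
    {K κ : ℕ} (h1 : ∀ U, ¬ B U → e U ≤ 1) (h2 : ∀ U, e U ≤ K)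
    (hB : K * (Finset.univ.filter B).card ≤ κ * N) :
    ∑ U, (N : ℝ≥0∞)⁻¹ * (e U : ℝ≥0∞) ≤ ((1 + κ : ℕ) : ℝ≥0∞) := by
  have hle : ∀ U, (e U : ℝ≥0∞) ≤ 1 + if B U then (K : ℝ≥0∞) else 0 := by
    intro U
    split_ifs with hU
    · exact (ENat.toENNReal_le.2 (h2 U)).trans (by simp)
    · simpa using ENat.toENNReal_le.2 (h1 U hU)
  have hsum : ∑ U, (e U : ℝ≥0∞) ≤ ((1 + κ : ℕ) : ℝ≥0∞) * N := by
    calc ∑ U, (e U : ℝ≥0∞) ≤ ∑ U : Fin N, (1 + if B U then (K : ℝ≥0∞) else 0) :=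
          Finset.sum_le_sum fun U _ => hle U
      _ = ((N + K * (Finset.univ.filter B).card : ℕ) : ℝ≥0∞) := by
          rw [Finset.sum_add_distrib, ← Finset.sum_filter]
          simp [mul_comm]
      _ ≤ (((1 + κ) * N : ℕ) : ℝ≥0∞) := by
          rw [add_mul, one_mul]; exact_mod_cast Nat.add_le_add_left hB N
      _ = ((1 + κ : ℕ) : ℝ≥0∞) * N := by push_cast; ring
  rw [← Finset.mul_sum]
  have hN0 : (N : ℝ≥0∞) ≠ 0 := by exact_mod_cast hN.ne'
  calc (N : ℝ≥0∞)⁻¹ * ∑ U, (e U : ℝ≥0∞) ≤ (N : ℝ≥0∞)⁻¹ * (((1 + κ : ℕ) : ℝ≥0∞) * N) := by gcongr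
    _ = ((1 + κ : ℕ) : ℝ≥0∞) := by
      rw [mul_comm, mul_assoc, ENNReal.mul_inv_cancel hN0 (by simp), mul_one]

/-- To bound the expected stretch of a random map it suffices to bound it on edges. -/
theorem expectation_le_of_edges {N : ℕ} {D : ℝ≥0} {W : Fin N → Type} (H : ∀ U, SimpleGraph (W U))
    (f : ∀ U, V → W U) (hG : G.Connected)
    (hadj : ∀ x y, G.Adj x y →
      ∑ U, (N : ℝ≥0∞)⁻¹ * ((H U).edist (f U x) (f U y) : ℝ≥0∞) ≤ D) (x y : V) :
    ∑ U, (N : ℝ≥0∞)⁻¹ * ((H U).edist (f U x) (f U y) : ℝ≥0∞) ≤ D * (G.edist x y : ℝ≥0∞) := by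
  have key : ∀ x y (w : G.Walk x y),
      ∑ U, (N : ℝ≥0∞)⁻¹ * ((H U).edist (f U x) (f U y) : ℝ≥0∞) ≤ D * (w.length : ℝ≥0∞) := by
    intro x y w
    induction w with
    | nil => simp
    | @cons x z y h w ih =>
      calc ∑ U, (N : ℝ≥0∞)⁻¹ * ((H U).edist (f U x) (f U y) : ℝ≥0∞)
          ≤ ∑ U, ((N : ℝ≥0∞)⁻¹ * ((H U).edist (f U x) (f U z) : ℝ≥0∞) +
            (N : ℝ≥0∞)⁻¹ * ((H U).edist (f U z) (f U y) : ℝ≥0∞)) := by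
            refine Finset.sum_le_sum fun U _ => ?_
            rw [← mul_add, ← ENat.toENNReal_add]
            gcongr
            exact SimpleGraph.edist_triangle
        _ ≤ D + D * (w.length : ℝ≥0∞) := by
            rw [Finset.sum_add_distrib]
            exact add_le_add (hadj x z h) ih
        _ = D * ((SimpleGraph.Walk.cons h w).length : ℝ≥0∞) := by
            rw [SimpleGraph.Walk.length_cons]; push_cast; ring
  obtain ⟨w, hw⟩ := hG.exists_walk_length_eq_edist x y
  rw [← hw]
  simpa using key x y w

/-- An edge inside a layer has length at most `28 * 4 ^ q` if it is cut, and it is cut by the cut of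
its scale `q` with probability at most `4 ^ (-q)` and by that of the previous scale with probability
at most `4 ^ (1 - q)`, which bounds its expected length by `1 + 28 + 112 = 141`. For the edges to
the parents the same reasoning gives a smaller bound. -/
theorem IsCyclicChart.stochasticallyEmbeds (hC : IsCyclicChart G Δ n vtx P) :
    StochasticallyEmbeds G 141 (OneSumClosure fun _ H => IsPyramid H) := by
  classical
  obtain ⟨F, hF⟩ := hC.exists_firstChild
  -- A sample space on which all the required residues of `U` are uniform.
  let N : ℕ := ∏ i ∈ Finset.range Δ, n i * 4 ^ layerScale n i
  have hN : 0 < N := Finset.prod_pos fun i _ => Nat.mul_pos (hC.n_pos i) (by positivity)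
  have hNn : ∀ i < Δ, n i ∣ N := fun i hi =>
    (Dvd.intro _ rfl).trans (Finset.dvd_prod_of_mem _ (Finset.mem_range.2 hi))
  have hNs : ∀ i < Δ, 4 ^ layerScale n i ∣ N := fun i hi =>
    (Dvd.intro_left _ rfl).trans (Finset.dvd_prod_of_mem _ (Finset.mem_range.2 hi))
  have hembed := fun U : Fin N => hC.exists_strip_embedding (g := apexHeight n U)
    (by simp [apexHeight]) (hC.isCut hF U) (fun i hi => by
      rw [apexHeight] at hi ⊢
      split_ifs at hi ⊢ with h
      · rfl
      · exact absurd rfl hi)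
  choose W H f hclosure hlow hrow hrow1 hcol hcol1 using hembed
  have : Nonempty (Fin N) := ⟨⟨0, hN⟩⟩
  refine ⟨Fin N, PMF.uniformOfFintype (Fin N), W, H, f, hclosure, hlow, fun x y => ?_⟩
  rw [tsum_fintype]
  simp only [PMF.uniformOfFintype_apply, Fintype.card_fin]
  refine expectation_le_of_edges H f hC.connected (fun x y hxy => ?_) x y
  have hpow : ∀ i, layerBound n i ≤ 4 * 4 ^ layerScale n i := fun i => by
    have := layerBound_lt_pow n i; rw [pow_succ] at this; omega
  have hhor : ∀ i < Δ, ∀ x, ∑ U, (N : ℝ≥0∞)⁻¹ *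
      ((H U).edist (f U (vtx i x)) (f U (vtx i (x + 1))) : ℝ≥0∞) ≤ (141 : ℝ≥0) := by
    intro i hi x
    set q := layerScale n i
    -- The edge is cut only by the cuts of its own scale and of the previous one.
    let B : ℕ → Fin N → Prop := fun r U => (n i : ℤ) ∣ x + 1 - cutLine F U (scaleStart n r) i
    have hB : ∀ r ≤ q, 4 ^ r * (Finset.univ.filter (B r)).card ≤ N := by
      intro r hr
      have hs := hC.scaleStart_le hr
      obtain ⟨R, hR⟩ := hC.exists_cutLine_start hF hs (x + 1)
      have h1 := card_filter_dvd_mul_le (hNn _ (by omega)) R (B r)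
        fun U hU => hR U hU
      have h2 : 4 ^ r ≤ n (scaleStart n r) :=
        (hC.pow_le_layerBound_scaleStart hr).trans (hC.layerBound_le _)
      rw [mul_comm]
      exact (Nat.mul_le_mul_left _ h2).trans h1
    have := expectation_le (κ := 140) hN
      (fun U => (H U).edist (f U (vtx i x)) (f U (vtx i (x + 1))))
      (fun U => B q U ∨ B (q - 1) U) (K := 3 * layerBound n i + 4) (fun U hU => ?_)
      (fun U => hrow U i hi x) ?_
    · exact_mod_cast this
    · refine hrow1 U i hi x fun hdvd => hU ?_
      have hc : cutScale n U i = q ∨ cutScale n U i = q - 1 := by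
        rw [cutScale]; split_ifs
        · exact Or.inl rfl
        · exact Or.inr rfl
      rcases hc with h | h
      · left; rw [h] at hdvd; exact hdvd
      · right; rw [h] at hdvd; exact hdvd
    · have h1 := hB q le_rfl
      have h2 := hB (q - 1) (Nat.sub_le _ _)
      have h3 : (Finset.univ.filter fun U => B q U ∨ B (q - 1) U).card ≤
          (Finset.univ.filter (B q)).card + (Finset.univ.filter (B (q - 1))).card := by
        rw [Finset.filter_or]; exact Finset.card_union_le _ _
      have h4 : 4 ^ q ≤ 4 * 4 ^ (q - 1) := by
        rw [← pow_succ']; exact Nat.pow_le_pow_right (by norm_num) (by omega)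
      have h5 : 3 * layerBound n i + 4 ≤ 28 * 4 ^ q := by
        have : layerBound n i ≤ 4 * 4 ^ q := hpow i
        have : 1 ≤ 4 ^ q := Nat.one_le_pow _ _ (by norm_num)
        omega
      calc (3 * layerBound n i + 4) * (Finset.univ.filter fun U => B q U ∨ B (q - 1) U).card
          ≤ (28 * 4 ^ q) *
            ((Finset.univ.filter (B q)).card + (Finset.univ.filter (B (q - 1))).card) :=
            Nat.mul_le_mul h5 h3
        _ = 28 * (4 ^ q * (Finset.univ.filter (B q)).card) +
            28 * (4 ^ q * (Finset.univ.filter (B (q - 1))).card) := by ring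
        _ ≤ 28 * N + 28 * (4 * 4 ^ (q - 1) * (Finset.univ.filter (B (q - 1))).card) := by
            gcongr
        _ = 28 * N + 112 * (4 ^ (q - 1) * (Finset.univ.filter (B (q - 1))).card) := by ring
        _ ≤ 28 * N + 112 * N := by gcongr
        _ = 140 * N := by ring
  have hver : ∀ i, i + 1 < Δ → ∀ x, ∑ U, (N : ℝ≥0∞)⁻¹ *
      ((H U).edist (f U (vtx (i + 1) x)) (f U (vtx i (P i x))) : ℝ≥0∞) ≤ (141 : ℝ≥0) := by
    intro i hi x
    set q := layerScale n (i + 1)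
    have := expectation_le (κ := 140) hN
      (fun U => (H U).edist (f U (vtx (i + 1) x)) (f U (vtx i (P i x))))
      (fun U => i + 1 = apexLayer n U q) (K := 11 * layerBound n (i + 1)) (fun U hU => ?_)
      (fun U => hcol U i hi x) ?_
    · exact_mod_cast this
    · refine hcol1 U i hi x ?_
      rw [apexHeight, if_neg fun h => hU h.2]
    · have h1 := card_filter_dvd_mul_le (hNs _ hi)
        ((i + 1 : ℕ) - (scaleStart n q : ℕ) : ℤ) (fun U : Fin N => i + 1 = apexLayer n U q)
        fun U hU => by
          have hU' : ((i + 1 : ℕ) : ℤ) = scaleStart n q + ((U : ℕ) % 4 ^ q : ℕ) := by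
            exact_mod_cast hU
          rw [hU', add_sub_cancel_left, ← dvd_neg, neg_sub]
          exact_mod_cast Int.dvd_self_sub_emod (x := ((U : ℕ) : ℤ)) (m := ((4 ^ q : ℕ) : ℤ))
      have h2 : 11 * layerBound n (i + 1) ≤ 44 * 4 ^ q := by
        have : layerBound n (i + 1) ≤ 4 * 4 ^ q := hpow (i + 1)
        omega
      calc 11 * layerBound n (i + 1) *
            (Finset.univ.filter fun U : Fin N => i + 1 = apexLayer n U q).card
          ≤ 44 * 4 ^ q * (Finset.univ.filter fun U : Fin N => i + 1 = apexLayer n U q).card := by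
            gcongr
        _ = 44 * ((Finset.univ.filter fun U : Fin N => i + 1 = apexLayer n U q).card * 4 ^ q) := by
            ring
        _ ≤ 44 * N := by gcongr
        _ ≤ 140 * N := by gcongr; norm_num
  rcases hC.adj_cases x y hxy with ⟨i, hi, s, ⟨rfl, rfl⟩ | ⟨rfl, rfl⟩⟩ |
    ⟨i, hi, s, ⟨rfl, rfl⟩ | ⟨rfl, rfl⟩⟩
  · exact hhor i hi s
  · simp only [SimpleGraph.edist_comm (u := f _ (vtx i (s + 1)))]
    exact hhor i hi s
  · exact hver i hi s
  · simp only [SimpleGraph.edist_comm (u := f _ (vtx i (P i s)))]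
    exact hver i hi s

end RandomCut

theorem mainTheorem3 :
    ∃ D : ℝ≥0, 1 ≤ D ∧
      ∀ (V : Type*) (G : SimpleGraph V), IsFunnel G →
        StochasticallyEmbeds G D (OneSumClosure fun _ H => IsPyramid H) := by
  refine ⟨141, by norm_num, fun V G hG => ?_⟩
  obtain ⟨Δ, n, vtx, P, hC⟩ := hG.exists_isCyclicChart
  exact hC.stochasticallyEmbeds
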